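/- Let $\mathcal{A}$ be a proto-abelian category: $\mathcal A$ has a zero object; every span $C\twoheadleftarrow A\hookrightarrow B$ completes to a pushout square and every cospan $C\hookrightarrow D\twoheadleftarrow B$ completes to a pullback square, both of the form $$\begin{array}{ccc}A&\hookrightarrow&B\\ \downarrow&&\downarrow\\ C&\hookrightarrow&D\end{array}$$ with horizontal monomorphisms and vertical epimorphisms; and a commutative square of this form is a pushout if and only if it is a pullback. Let $\mathcal{Q}\subseteq\mathcal{A}$ be a quotient datum, that is, a (not necessarily full, wide or replete) subcategory such that, for every epimorphism $q$ of $\mathcal A$ lying in $\mathcal Q$, every factorization $X\twoheadrightarrow Z\twoheadrightarrow Y$ of $q$ into epimorphisms of $\mathcal{A}$ is isomorphic (through an isomorphism $Z\cong Z'$ of $\mathcal A$) to a factorization $X\twoheadrightarrow Z'\twoheadrightarrow Y$ in $\mathcal{Q}$, and every isomorphism of $\mathcal A$ between the middle objects of two such factorizations of $q$ in $\mathcal{Q}$ that is compatible with the factorizations lies in $\mathcal{Q}$. Let $\mathcal{X}^{\mathcal A}$ be Waldhausen's S-construction: the simplicial groupoid whose value on $[n]$ is the groupoid of flags $0=A_0\hookrightarrow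 A_1\hookrightarrow\dots\hookrightarrow A_n$ in $\mathcal{A}$ with chosen subquotients, i.e. of diagrams $(A_{i,j})_{0\le i\le j\le n}$ (thought of as $A_j/A_i$) with $A_{i,i}=0$, with monomorphisms $A_{i,j}\hookrightarrow A_{i,k}$ and epimorphisms $A_{i,k}\twoheadrightarrow A_{j,k}$, in which all squares with corners $A_{i,k},A_{i,l},A_{j,k},A_{j,l}$ ($i\le j\le k\le l$) are pullbacks and pushouts, and of isomorphisms of such diagrams. Let $\mathcal{Y}^{\mathcal A,\mathcal Q}$ be the simplicial groupoid whose value on $[n]$ is the groupoid of flags $0=A_0\hookrightarrow A_1\hookrightarrow\dots\hookrightarrow A_n\hookrightarrow A_{+\infty}$ with chosen subquotients, in which the quotients $A_{+\infty}/A_i$ ($0\le i\le n$) and the morphisms $A_{+\infty}/A_i\twoheadrightarrow A_{+\infty}/A_j$ ($i\le j$) lie in $\mathcal{Q}$; its morphisms are the isomorphisms of flags whose components at the quotients $A_{+\infty}/A_i$ ($0\le i\le n$) are isomorphisms of $\mathcal{Q}$. Here a monotone map $[m]\to[n]$ acts by restriction along its extension that preserves $+\infty$. Then the morphism of simplicial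 groupoids $\mathcal{Y}^{\mathcal A,\mathcal Q}\to\mathcal{X}^{\mathcal A}$ that forgets $A_{+\infty}$ is a $2$-Segal morphism. This means that, writing $\mathcal X=\mathcal X^{\mathcal A}$ and $\mathcal Y=\mathcal Y^{\mathcal A,\mathcal Q}$, the following canonical functors to homotopy fibre products of groupoids are equivalences: 1. ($\mathcal{X}$ is $2$-Segal) for all $0\le i<j\le n$, the functor $\mathcal{X}_{\{0,\dots,n\}}\to\mathcal{X}_{\{0,\dots,i,j,\dots,n\}}\times_{\mathcal{X}_{\{i,j\}}}\mathcal{X}_{\{i,\dots,j\}}$, and (unitality) for all $0\le i\le n$, the functor $\mathcal{X}_{[n]}\to\mathcal{X}_{[n+1]}\times_{\mathcal{X}_{\{i,i+1\}}}\mathcal{X}_{[0]}$ given by the $i$-th degeneracy and the vertex $i$; 2. for all $0\le i<j\le n$, the functor $\mathcal{Y}_{\{0,\dots,n\}}\to\mathcal{Y}_{\{0,\dots,i,j,\dots,n\}}\times_{\mathcal{X}_{\{i,j\}}}\mathcal{X}_{\{i,\dots,j\}}$, and for all $0\le i\le n$, the functor $\mathcal{Y}_{[n]}\to\mathcal{Y}_{[n+1]}\times_{\mathcal{X}_{\{i,i+1\}}}\mathcal{X}_{[0]}$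 given by the $i$-th degeneracy and the vertex $i$; 3. for all $0\le i\le n$, the functor $\mathcal{Y}_{\{0,\dots,n\}}\to\mathcal{Y}_{\{0,\dots,i\}}\times_{\mathcal{Y}_{\{i\}}}\mathcal{Y}_{\{i,\dots,n\}}$. -/

import Mathlib

open CategoryTheory Limits Opposite

universe v u

/-! ### Proto-abelian categories -/

/-- A category is *proto-abelian* if it is pointed (has a zero object), every span consisting of a
monomorphism and an epimorphism completes to a pushout square, every cospan consisting of an
epimorphism and a monomorphism completes to a pullback square, both of the form
```
  a ↪ b
  ↡   ↡
  c ↪ d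
```
and a commutative square of this form is a pushout if and only if it is a pullback. -/
class ProtoAbelian (A : Type u) [Category.{v} A] : Prop where
  hasZeroObject : HasZeroObject A
  exists_isPushout : ∀ {a b c : A} (f : a ⟶ b) (g : a ⟶ c), Mono f → Epi g →
    ∃ (d : A) (h : b ⟶ d) (k : c ⟶ d), Epi h ∧ Mono k ∧ IsPushout f g h k
  exists_isPullback : ∀ {b c d : A} (h : b ⟶ d) (k : c ⟶ d), Epi h → Mono k →
    ∃ (a : A) (f : a ⟶ b) (g : a ⟶ c), Mono f ∧ Epi g ∧ IsPullback f g h k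
  isPushout_iff_isPullback : ∀ {a b c d : A} (f : a ⟶ b) (g : a ⟶ c) (h : b ⟶ d) (k : c ⟶ d),
    Mono f → Epi g → Epi h → Mono k → (IsPushout f g h k ↔ IsPullback f g h k)

/-! ### Quotient data -/

/-- A *quotient datum* in `A`: a subcategory `Q ⊆ A` (neither full, nor wide, nor closed under
isomorphisms in general) such that, for each epimorphism `q` of `A` that lies in `Q`, every
factorization of `q` into epimorphisms of `A` is isomorphic to a factorization in `Q`, and every
isomorphism of `A` between two such factorizations in `Q` lies in `Q`. -/
structure QuotientDatum (A : Type u) [Category.{v} A] where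
  /-- the objects of `Q` -/
  obj : ObjectProperty A
  /-- the morphisms of `Q` -/
  hom : MorphismProperty A
  source_mem : ∀ {x y : A} (f : x ⟶ y), hom f → obj x
  target_mem : ∀ {x y : A} (f : x ⟶ y), hom f → obj y
  id_mem : ∀ x : A, obj x → hom (𝟙 x)
  comp_mem : ∀ {x y z : A} (f : x ⟶ y) (g : y ⟶ z), hom f → hom g → hom (f ≫ g)
  exists_factorization : ∀ {x z y : A} (f : x ⟶ z) (g : z ⟶ y), Epi f → Epi g → hom (f ≫ g) →
    ∃ (z' : A) (e : z ≅ z'), hom (f ≫ e.hom) ∧ hom (e.inv ≫ g)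
  iso_mem : ∀ {x z z' y : A} (f : x ⟶ z) (g : z ⟶ y) (e : z ≅ z'), Epi f → Epi g →
    hom f → hom g → hom (f ≫ e.hom) → hom (e.inv ≫ g) → hom e.hom

/-! ### Flags with chosen subquotients -/

/-- The poset of pairs `i ≤ j` in `I`, ordered componentwise. -/
abbrev IntervalPoset (I : Type) [Preorder I] : Type := {p : I × I // p.1 ≤ p.2}

namespace IntervalPoset

variable {I J K : Type} [Preorder I] [Preorder J] [Preorder K]

/-- The pair `i ≤ j`. -/
abbrev mk {i j : I} (h : i ≤ j) : IntervalPoset I := ⟨(i, j), h⟩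

/-- The morphism `(i, j) ⟶ (k, l)` for `i ≤ k` and `j ≤ l`. -/
abbrev homMk {i j k l : I} (hij : i ≤ j) (hkl : k ≤ l) (hik : i ≤ k) (hjl : j ≤ l) :
    mk hij ⟶ mk hkl :=
  homOfLE (show mk hij ≤ mk hkl from ⟨hik, hjl⟩)

/-- The functor on pairs induced by a monotone map. -/
def map (f : I →o J) : IntervalPoset I ⥤ IntervalPoset J :=
  Monotone.functor (f := fun p => (⟨(f p.1.1, f p.1.2), f.monotone p.2⟩ : IntervalPoset J))
    (fun _ _ h => ⟨f.monotone h.1, f.monotone h.2⟩)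

end IntervalPoset

/-- A *flag indexed by `I` with chosen subquotients*: a diagram of objects `A_{i,j}` (`i ≤ j`),
to be thought of as `A_j / A_i`, with `A_{i,i} = 0`, with monomorphisms `A_{i,j} ↪ A_{i,k}` and
epimorphisms `A_{i,k} ↠ A_{j,k}`, in which all squares
```
  A_{i,k} ↪ A_{i,l}
    ↡         ↡
  A_{j,k} ↪ A_{j,l}
```
are bicartesian (for `j = k` this says that `A_{i,j} ↪ A_{i,l} ↠ A_{j,l}` is short exact). -/
structure WaldhausenFlag (I : Type) [Preorder I] (A : Type u) [Category.{v} A] where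
  diagram : IntervalPoset I ⥤ A
  isZero : ∀ i : I, IsZero (diagram.obj (IntervalPoset.mk (le_refl i)))
  mono : ∀ {i j k : I} (hij : i ≤ j) (hjk : j ≤ k),
    Mono (diagram.map (IntervalPoset.homMk hij (hij.trans hjk) le_rfl hjk))
  epi : ∀ {i j k : I} (hij : i ≤ j) (hjk : j ≤ k),
    Epi (diagram.map (IntervalPoset.homMk (hij.trans hjk) hjk hij le_rfl))
  isPullback : ∀ {i j k l : I} (hij : i ≤ j) (hjk : j ≤ k) (hkl : k ≤ l),
    IsPullback
      (diagram.map (IntervalPoset.homMk (hij.trans hjk) (hij.trans (hjk.trans hkl)) le_rfl hkl))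
      (diagram.map (IntervalPoset.homMk (hij.trans hjk) hjk hij le_rfl))
      (diagram.map (IntervalPoset.homMk (hij.trans (hjk.trans hkl)) (hjk.trans hkl) hij le_rfl))
      (diagram.map (IntervalPoset.homMk hjk (hjk.trans hkl) le_rfl hkl))
  isPushout : ∀ {i j k l : I} (hij : i ≤ j) (hjk : j ≤ k) (hkl : k ≤ l),
    IsPushout
      (diagram.map (IntervalPoset.homMk (hij.trans hjk) (hij.trans (hjk.trans hkl)) le_rfl hkl))
      (diagram.map (IntervalPoset.homMk (hij.trans hjk) hjk hij le_rfl))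
      (diagram.map (IntervalPoset.homMk (hij.trans (hjk.trans hkl)) (hjk.trans hkl) hij le_rfl))
      (diagram.map (IntervalPoset.homMk hjk (hjk.trans hkl) le_rfl hkl))

namespace WaldhausenFlag

variable {I J : Type} [Preorder I] [Preorder J] {A : Type u} [Category.{v} A]

/-- Flags form a groupoid, with the isomorphisms of diagrams as morphisms. -/
instance : Groupoid.{v} (WaldhausenFlag I A) where
  Hom D E := D.diagram ≅ E.diagram
  id D := Iso.refl D.diagram
  comp f g := f ≪≫ g
  inv f := f.symm

/-- Restriction of flags along a monotone map. -/
def restrict (f : I →o J) (D : WaldhausenFlag J A) : WaldhausenFlag I A where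
  diagram := IntervalPoset.map f ⋙ D.diagram
  isZero i := D.isZero (f i)
  mono hij hjk := D.mono (f.monotone hij) (f.monotone hjk)
  epi hij hjk := D.epi (f.monotone hij) (f.monotone hjk)
  isPullback hij hjk hkl := D.isPullback (f.monotone hij) (f.monotone hjk) (f.monotone hkl)
  isPushout hij hjk hkl := D.isPushout (f.monotone hij) (f.monotone hjk) (f.monotone hkl)

/-- Restriction of flags along a monotone map, as a functor. -/
def restrictFunctor (f : I →o J) (A : Type u) [Category.{v} A] : WaldhausenFlag J A ⥤ WaldhausenFlag I A where
  obj D := D.restrict f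
  map {D E} (φ : D.diagram ≅ E.diagram) := Functor.isoWhiskerLeft (IntervalPoset.map f) φ

end WaldhausenFlag

/-! ### Waldhausen's S-construction -/

/-- Waldhausen's S-construction: the simplicial groupoid sending `[n]` to the groupoid of flags
`0 = A_0 ↪ A_1 ↪ ⋯ ↪ A_n` (with chosen subquotients). -/
def waldhausenS (A : Type u) [Category.{v} A] : SimplicialObject Grpd.{v, max u v} where
  obj n := Grpd.of (WaldhausenFlag (Fin (n.unop.len + 1)) A)
  map f := WaldhausenFlag.restrictFunctor f.unop.toOrderHom A

/-! ### The bounded S-construction -/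

namespace QuotientDatum

variable {A : Type u} [Category.{v} A] (Q : QuotientDatum A)
variable {I J : Type} [Preorder I] [Preorder J]

/-- A *bounded flag*: a flag indexed by `I` with a top element `+∞` adjoined, such that the
quotients `A_{+∞} / A_i` with `i ∈ I` and the morphisms `A_{+∞} / A_i ↠ A_{+∞} / A_j` between them
lie in `Q` (the condition on objects is the case `i = j`). -/
structure BoundedFlag (I : Type) [Preorder I] where
  flag : WaldhausenFlag (WithTop I) A
  mem : ∀ {i j : I} (hij : i ≤ j), Q.hom (flag.diagram.map
    (IntervalPoset.homMk (le_top : (i : WithTop I) ≤ ⊤) (le_top : (j : WithTop I) ≤ ⊤)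
      (WithTop.coe_le_coe.mpr hij) le_rfl))

namespace BoundedFlag

variable {Q}

/-- An isomorphism of bounded flags: an isomorphism of the underlying flags whose components at the
quotients `A_{+∞} / A_i` are isomorphisms of the category `Q`. -/
@[ext]
structure Hom (D E : Q.BoundedFlag I) where
  iso : D.flag.diagram ≅ E.flag.diagram
  hom_mem : ∀ i : I, Q.hom (iso.hom.app (IntervalPoset.mk (le_top : (i : WithTop I) ≤ ⊤)))
  inv_mem : ∀ i : I, Q.hom (iso.inv.app (IntervalPoset.mk (le_top : (i : WithTop I) ≤ ⊤)))

theorem quotient_mem (D : Q.BoundedFlag I) (i : I) :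
    Q.obj (D.flag.diagram.obj (IntervalPoset.mk (le_top : (i : WithTop I) ≤ ⊤))) :=
  Q.source_mem _ (D.mem (le_refl i))

instance : Groupoid.{v} (Q.BoundedFlag I) where
  Hom D E := Hom D E
  id D := ⟨Iso.refl _, fun i => Q.id_mem _ (D.quotient_mem i),
    fun i => Q.id_mem _ (D.quotient_mem i)⟩
  comp f g := ⟨f.iso ≪≫ g.iso, fun i => Q.comp_mem _ _ (f.hom_mem i) (g.hom_mem i),
    fun i => Q.comp_mem _ _ (g.inv_mem i) (f.inv_mem i)⟩
  inv f := ⟨f.iso.symm, f.inv_mem, f.hom_mem⟩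
  id_comp _ := Hom.ext (Iso.refl_trans _)
  comp_id _ := Hom.ext (Iso.trans_refl _)
  assoc _ _ _ := Hom.ext (Iso.trans_assoc _ _ _)
  inv_comp _ := Hom.ext (Iso.symm_self_id _)
  comp_inv _ := Hom.ext (Iso.self_symm_id _)

end BoundedFlag

/-- The monotone map `I ∪ {+∞} → J ∪ {+∞}` extending `f` and preserving `+∞`. -/
def extendTop (f : I →o J) : WithTop I →o WithTop J := f.withTopMap

/-- Restriction of bounded flags along a monotone map (fixing `+∞`). -/
def restrictFunctor (f : I →o J) : Q.BoundedFlag J ⥤ Q.BoundedFlag I where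
  obj D := ⟨D.flag.restrict (extendTop f), fun hij => D.mem (f.monotone hij)⟩
  map φ := ⟨Functor.isoWhiskerLeft (IntervalPoset.map (extendTop f)) φ.iso,
    fun i => φ.hom_mem (f i), fun i => φ.inv_mem (f i)⟩

/-- The inclusion of bounded flags into all flags indexed by `I ∪ {+∞}`. -/
def inclusion (I : Type) [Preorder I] : Q.BoundedFlag I ⥤ WaldhausenFlag (WithTop I) A where
  obj D := D.flag
  map φ := φ.iso

theorem functor_ext {C : Type*} [Category* C] {F G : C ⥤ Q.BoundedFlag I}
    (h : F ⋙ Q.inclusion I = G ⋙ Q.inclusion I) : F = G := by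
  have hobj : ∀ X, F.obj X = G.obj X := fun X => by
    have h1 : (F.obj X).flag = (G.obj X).flag := Functor.congr_obj h X
    revert h1
    rcases F.obj X with ⟨D, hD⟩
    rcases G.obj X with ⟨E, hE⟩
    rintro (rfl : D = E)
    rfl
  refine CategoryTheory.Functor.ext hobj fun X Y f => ?_
  have key : (Q.inclusion I).map (F.map f) =
      (Q.inclusion I).map (eqToHom (hobj X) ≫ G.map f ≫ eqToHom (hobj Y).symm) := by
    rw [Functor.map_comp, Functor.map_comp, eqToHom_map, eqToHom_map]
    exact Functor.congr_hom h f
  exact BoundedFlag.Hom.ext key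

theorem restrictFunctor_id : Q.restrictFunctor (OrderHom.id : I →o I) = 𝟭 _ := by
  apply Q.functor_ext
  change Q.inclusion I ⋙ WaldhausenFlag.restrictFunctor (extendTop OrderHom.id) A = Q.inclusion I
  have h : extendTop (OrderHom.id : I →o I) = OrderHom.id := by
    ext x; cases x <;> rfl
  rw [h]
  rfl

theorem restrictFunctor_comp {K : Type} [Preorder K] (f : I →o J) (g : J →o K) :
    Q.restrictFunctor (g.comp f) = Q.restrictFunctor g ⋙ Q.restrictFunctor f := by
  apply Q.functor_ext
  change Q.inclusion K ⋙ WaldhausenFlag.restrictFunctor (extendTop (g.comp f)) A =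
    Q.inclusion K ⋙ WaldhausenFlag.restrictFunctor ((extendTop g).comp (extendTop f)) A
  have h : extendTop (g.comp f) = (extendTop g).comp (extendTop f) := by
    ext x; cases x <;> rfl
  rw [h]

/-- The functor forgetting `A_{+∞}`, from bounded flags to flags. -/
def forgetTop (I : Type) [Preorder I] : Q.BoundedFlag I ⥤ WaldhausenFlag I A where
  obj D := D.flag.restrict ⟨fun i => (i : WithTop I), fun _ _ h => WithTop.coe_le_coe.mpr h⟩
  map φ := Functor.isoWhiskerLeft _ φ.iso

/-- The bounded S-construction: the simplicial groupoid sending `[n]` to the groupoid of bounded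
flags `0 = A_0 ↪ A_1 ↪ ⋯ ↪ A_n ↪ A_{+∞}`. -/
def boundedS : SimplicialObject Grpd.{v, max u v} where
  obj n := Grpd.of (Q.BoundedFlag (Fin (n.unop.len + 1)))
  map f := Q.restrictFunctor f.unop.toOrderHom
  map_id _ := Q.restrictFunctor_id
  map_comp f g := Q.restrictFunctor_comp g.unop.toOrderHom f.unop.toOrderHom

/-- The morphism of simplicial groupoids from the bounded to the usual S-construction, which
forgets `A_{+∞}`. -/
def boundedSToWaldhausenS : Q.boundedS ⟶ waldhausenS A where
  app n := Q.forgetTop (Fin (n.unop.len + 1))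

end QuotientDatum

/-! ### Homotopy pullbacks of groupoids -/

namespace TwoSegal

/-- The canonical functor from the upper left corner of a strictly commutative square of categories
to the categorical pullback, whose objects are the triples `(x, y, r x ≅ b y)`. -/
def comparison {W U V Z : Type*} [Category* W] [Category* U] [Category* V] [Category* Z]
    {t : W ⥤ U} {l : W ⥤ V} {r : U ⥤ Z} {b : V ⥤ Z} (h : t ⋙ r = l ⋙ b) :
    W ⥤ CategoricalPullback r b where
  obj w := ⟨t.obj w, l.obj w, eqToIso (Functor.congr_obj h w)⟩
  map f := ⟨t.map f, l.map f, by
    have := Functor.congr_hom h f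
    simp only [Functor.comp_map] at this
    simp [this]⟩

/-- A commutative square of groupoids
```
  W --t--> U
  |        |
  l        r
  v        v
  V --b--> Z
```
is a *homotopy pullback* if the canonical functor from `W` to the groupoid of triples
`(x, y, r x ≅ b y)` is an equivalence. -/
structure IsHomotopyPullback {W U V Z : Grpd.{v, u}} (t : W ⟶ U) (l : W ⟶ V) (r : U ⟶ Z)
    (b : V ⟶ Z) : Prop where
  comm : t ≫ r = l ≫ b
  isEquivalence : (comparison (t := t) (l := l) (r := r) (b := b) comm).IsEquivalence

/-! ### The 2-Segal conditions -/

open Simplicial SimplexCategory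

/-- The interval `{i, …, i+m} ⊆ {0, …, i+m+r}`, as the map `k ↦ i + k`. -/
def innerPolygon (i m r : ℕ) : ⦋m⦌ ⟶ ⦋i + m + r⦌ :=
  mkHom ⟨fun k => ⟨i + k, by omega⟩, fun k l h => by
    have h' : (k : ℕ) ≤ l := h
    change i + (k : ℕ) ≤ i + l
    omega⟩

/-- For `m ≥ 1`, the inclusion of `{0, …, i, i+m, …, i+m+r}` into `{0, …, i+m+r}`.
For `m = 0`, the degeneracy `⦋i+1+r⦌ ⟶ ⦋i+r⦌` that identifies `i` and `i+1`. -/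
def outerPolygon (i m r : ℕ) : ⦋i + 1 + r⦌ ⟶ ⦋i + m + r⦌ :=
  mkHom ⟨fun k => ⟨if (k : ℕ) ≤ i then k else k + m - 1, by split_ifs <;> omega⟩, fun k l h => by
    have h' : (k : ℕ) ≤ l := h
    change (if (k : ℕ) ≤ i then (k : ℕ) else k + m - 1) ≤ (if (l : ℕ) ≤ i then (l : ℕ) else l + m - 1)
    split_ifs <;> omega⟩

/-- The endpoints `{0, m}` of `{0, …, m}`, as the map `k ↦ k * m`. -/
def endpoints (m : ℕ) : ⦋1⦌ ⟶ ⦋m⦌ :=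
  mkHom ⟨fun k => ⟨k * m, by
    have : (k : ℕ) * m ≤ 1 * m := Nat.mul_le_mul_right m (by omega)
    omega⟩, fun _ _ h => Nat.mul_le_mul_right m h⟩

/-- The initial segment `{0, …, i} ⊆ {0, …, i+r}`. -/
def initialSegment (i r : ℕ) : ⦋i⦌ ⟶ ⦋i + r⦌ :=
  mkHom ⟨fun k => ⟨k, by omega⟩, fun _ _ h => h⟩

/-- The final segment `{i, …, i+r} ⊆ {0, …, i+r}`. -/
def finalSegment (i r : ℕ) : ⦋r⦌ ⟶ ⦋i + r⦌ :=
  mkHom ⟨fun k => ⟨i + k, by omega⟩, fun k l h => by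
    have h' : (k : ℕ) ≤ l := h
    change i + (k : ℕ) ≤ i + l
    omega⟩

/-- A simplicial groupoid `X` is (unital) *2-Segal* if, for all `n = i + m + r` and `j = i + m`,
the square
```
  X_{0,…,n}         ⟶  X_{i,…,j}
      ↓                    ↓
  X_{0,…,i,j,…,n}   ⟶  X_{i,j}
```
is a homotopy pullback. For `m ≥ 1` these are the 2-Segal conditions for the diagonal `{i, j}` of
the polygon with vertices `0, …, n`; for `m = 0` the lower row is `X_{i+1+r} ⟶ X_1`, the vertical
maps are degenerate, and these are the unitality conditions. -/
def IsTwoSegal (X : SimplicialObject Grpd.{v, u}) : Prop :=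
  ∀ i m r : ℕ, IsHomotopyPullback
    (X.map (innerPolygon i m r).op) (X.map (outerPolygon i m r).op)
    (X.map (endpoints m).op) (X.map (innerPolygon i 1 r).op)

/-- A morphism `Φ : Y ⟶ X` of simplicial groupoids is *2-Segal* if the corresponding relative
simplicial groupoid, whose value on `{0, …, n}` is `X_n` and on `{0, …, n, +∞}` is `Y_n`, satisfies
the (unital) 2-Segal conditions:
* for polygons not containing `+∞`, this says that `X` is 2-Segal;
* for the polygon `{0, …, n, +∞}` and the diagonal `{i, j}` (and for the degeneracies identifying
  two finite vertices), the pieces are `{i, …, j}` and `{0, …, i, j, …, n, +∞}`;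
* for the polygon `{0, …, n, +∞}` and the diagonal `{i, +∞}`, the pieces are `{0, …, i, +∞}` and
  `{i, …, n, +∞}`. -/
structure IsTwoSegalMorphism {Y X : SimplicialObject Grpd.{v, u}} (Φ : Y ⟶ X) : Prop where
  isTwoSegal : IsTwoSegal X
  finite_diagonal : ∀ i m r : ℕ, IsHomotopyPullback
    (Y.map (innerPolygon i m r).op ≫ Φ.app (op ⦋m⦌)) (Y.map (outerPolygon i m r).op)
    (X.map (endpoints m).op) (Y.map (innerPolygon i 1 r).op ≫ Φ.app (op ⦋1⦌))
  infinite_diagonal : ∀ i r : ℕ, IsHomotopyPullback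
    (Y.map (initialSegment i r).op) (Y.map (finalSegment i r).op)
    (Y.map (const ⦋0⦌ ⦋i⦌ (Fin.last i)).op) (Y.map (const ⦋0⦌ ⦋r⦌ 0).op)

end TwoSegal

/-! A flag with a least index `⊥` is determined up to isomorphism by its chain of monomorphisms
`A_{⊥,j}`: every chain of monomorphisms is the chain of a flag of quotients
(`WaldhausenFlag.exists_presentation`), and isomorphic chains have isomorphic flags
(`Presentation.exists_iso`).

Cutting along a diagonal `{a, b}` is then the third isomorphism theorem. Refining the step `A_a ↪
A_b` amounts to giving a flag in `A_b / A_a`: its members are pulled back along `A_b ↠ A_b / A_a`,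
and the bicartesian squares recover them as subquotients. This gives essential surjectivity
(`IsDecomposition.exists_glue`). For fullness, an isomorphism on the outer piece preserves each
refined subobject because that subobject is a pullback of data on which the isomorphism is known
(`IsDecomposition.exists_iso`). Faithfulness holds because a morphism is determined by its component
at `A_{⊥,⊤}`. Unitality is the case of a one-point inner polygon, and `+∞` is treated as one more
greatest vertex.

It remains to control `Q`. For a finite diagonal, the new quotients `A_{+∞} / A_l` factor the
epimorphism `A_{+∞} / A_a ↠ A_{+∞} / A_b` of `Q`. The existence axiom, applied to one object at a
time, moves them into `Q` (`exists_chain_mem`); the axiom on isomorphisms puts the components of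
isomorphisms there into `Q` (`mem_of_outer_mem`). For the diagonal `{i, +∞}`, every quotient `A_{+∞}
/ A_k` already belongs to one of the pieces, and these share only `A_{+∞} / A_i`, where the
identification lies in `Q`. Nothing has to be factored. -/

/-! ### Monomorphisms and epimorphisms in proto-abelian categories -/

namespace CategoryTheory.Limits.IsZero

variable {C : Type u} [Category.{v} C]

theorem comp_eq_comp {X Y Z Z' : C} (hZ : IsZero Z) (hZ' : IsZero Z') (f : X ⟶ Z) (g : Z ⟶ Y)
    (f' : X ⟶ Z') (g' : Z' ⟶ Y) : f ≫ g = f' ≫ g' := by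
  rw [hZ'.eq_of_tgt f' (f ≫ hZ.to_ Z'), Category.assoc, hZ.eq_of_src g (hZ.to_ Z' ≫ g')]

theorem epi_of_tgt {X Z : C} (hZ : IsZero Z) (f : X ⟶ Z) : Epi f :=
  ⟨fun _ _ _ => hZ.eq_of_src _ _⟩

end CategoryTheory.Limits.IsZero

namespace ProtoAbelian

variable {A : Type u} [Category.{v} A] [ProtoAbelian A]
variable {a b c d : A} {f : a ⟶ b} {g : a ⟶ c} {h : b ⟶ d} {k : c ⟶ d}

/-- The axiom provides one pushout with this property; uniqueness of pushouts carries it to all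
others. -/
theorem mono_of_isPushout (H : IsPushout f g h k) (hf : Mono f) (hg : Epi g) : Mono k := by
  obtain ⟨d', h', k', _, _, H'⟩ := exists_isPushout f g hf hg
  have : k = k' ≫ (H'.isoIsPushout _ _ H).hom := (H'.inr_isoIsPushout_hom _ _ H).symm
  rw [this]
  infer_instance

theorem epi_of_isPullback (H : IsPullback f g h k) (hh : Epi h) (hk : Mono k) : Epi g := by
  obtain ⟨a', f', g', _, _, H'⟩ := exists_isPullback h k hh hk
  have : g = (H.isoIsPullback _ _ H').hom ≫ g' := (H.isoIsPullback_hom_snd _ _ H').symm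
  rw [this]
  infer_instance

theorem isPullback_of_isPushout (H : IsPushout f g h k) (hf : Mono f) (hg : Epi g) :
    IsPullback f g h k :=
  (isPushout_iff_isPullback f g h k hf hg (H.epi_inl_of_epi) (mono_of_isPushout H hf hg)).1 H

theorem isPushout_of_isPullback (H : IsPullback f g h k) (hh : Epi h) (hk : Mono k) :
    IsPushout f g h k :=
  (isPushout_iff_isPullback f g h k H.mono_fst_of_mono (epi_of_isPullback H hh hk) hh hk).2 H

end ProtoAbelian

/-! ### Structure maps of flags and transport along isomorphisms -/

namespace WaldhausenFlag

variable {I J K : Type} [Preorder I] [Preorder J] [Preorder K] {A : Type u} [Category.{v} A]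

/-- The object `A_{i,j}` of a flag. -/
abbrev obj (D : WaldhausenFlag I A) {i j : I} (h : i ≤ j) : A :=
  D.diagram.obj (IntervalPoset.mk h)

/-- The morphism `A_{i,j} ⟶ A_{k,l}` of a flag, for `i ≤ k` and `j ≤ l`. -/
abbrev map (D : WaldhausenFlag I A) {i j k l : I} (hij : i ≤ j) (hkl : k ≤ l) (hik : i ≤ k)
    (hjl : j ≤ l) : D.obj hij ⟶ D.obj hkl :=
  D.diagram.map (IntervalPoset.homMk hij hkl hik hjl)

section

variable (D : WaldhausenFlag I A) {i j k l m n : I}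

theorem map_comp_map (hij : i ≤ j) (hkl : k ≤ l) (hmn : m ≤ n) (hik : i ≤ k) (hjl : j ≤ l)
    (hkm : k ≤ m) (hln : l ≤ n) :
    D.map hij hkl hik hjl ≫ D.map hkl hmn hkm hln =
      D.map hij hmn (hik.trans hkm) (hjl.trans hln) :=
  (D.diagram.map_comp _ _).symm

theorem map_comp_map_assoc (hij : i ≤ j) (hkl : k ≤ l) (hmn : m ≤ n) (hik : i ≤ k) (hjl : j ≤ l)
    (hkm : k ≤ m) (hln : l ≤ n) {Z : A} (f : D.obj hmn ⟶ Z) :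
    D.map hij hkl hik hjl ≫ D.map hkl hmn hkm hln ≫ f =
      D.map hij hmn (hik.trans hkm) (hjl.trans hln) ≫ f := by
  rw [← Category.assoc, map_comp_map]

theorem map_self (hij : i ≤ j) : D.map hij hij le_rfl le_rfl = 𝟙 _ :=
  D.diagram.map_id _

theorem isZero_obj (hij : i ≤ j) (hji : j ≤ i) : IsZero (D.obj hij) :=
  (D.isZero i).of_iso ⟨D.map hij le_rfl le_rfl hji, D.map le_rfl hij le_rfl hij,
    by rw [map_comp_map, map_self], by rw [map_comp_map, map_self]⟩

theorem mono_map (hij : i ≤ j) (hik : i ≤ k) (hjk : j ≤ k) : Mono (D.map hij hik le_rfl hjk) :=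
  D.mono hij hjk

theorem epi_map (hik : i ≤ k) (hjk : j ≤ k) (hij : i ≤ j) : Epi (D.map hik hjk hij le_rfl) :=
  D.epi hij hjk

theorem isIso_map (hij : i ≤ j) (hkl : k ≤ l) (hik : i ≤ k) (hjl : j ≤ l) (hki : k ≤ i)
    (hlj : l ≤ j) : IsIso (D.map hij hkl hik hjl) :=
  ⟨D.map hkl hij hki hlj, by rw [map_comp_map, map_self], by rw [map_comp_map, map_self]⟩

theorem naturality {D E : WaldhausenFlag I A} (φ : D.diagram ⟶ E.diagram) (hij : i ≤ j)
    (hkl : k ≤ l) (hik : i ≤ k) (hjl : j ≤ l) :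
    D.map hij hkl hik hjl ≫ φ.app (IntervalPoset.mk hkl) =
      φ.app (IntervalPoset.mk hij) ≫ E.map hij hkl hik hjl :=
  φ.naturality _

end

/-- The components of a morphism between restrictions of flags. -/
def restrictApp {f : I →o J} {D E : WaldhausenFlag J A}
    (φ : (D.restrict f).diagram ⟶ (E.restrict f).diagram) {i j : I} (h : i ≤ j)
    (h' : f i ≤ f j) : D.obj h' ⟶ E.obj h' :=
  φ.app (IntervalPoset.mk h)

section

variable {f : I →o J} {D E : WaldhausenFlag J A}
  (φ : (D.restrict f).diagram ⟶ (E.restrict f).diagram)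
  {i j k l : I} (hij : i ≤ j) (hkl : k ≤ l) (hij' : f i ≤ f j) (hkl' : f k ≤ f l)

theorem restrictApp_naturality (hik : i ≤ k) (hjl : j ≤ l) (hik' : f i ≤ f k)
    (hjl' : f j ≤ f l) :
    D.map hij' hkl' hik' hjl' ≫ restrictApp φ hkl hkl' =
      restrictApp φ hij hij' ≫ E.map hij' hkl' hik' hjl' :=
  φ.naturality (IntervalPoset.homMk hij hkl hik hjl)

end

/-- The components of a morphism from the restriction of a flag to a flag. -/
def ofRestrictApp {f : I →o J} {D : WaldhausenFlag J A} {E : WaldhausenFlag I A}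
    (φ : (D.restrict f).diagram ⟶ E.diagram) {i j : I} (h : i ≤ j) (h' : f i ≤ f j) :
    D.obj h' ⟶ E.obj h :=
  φ.app (IntervalPoset.mk h)

/-- Transport of a flag along an isomorphism of diagrams. -/
def ofIso (D : WaldhausenFlag I A) {F : IntervalPoset I ⥤ A} (e : D.diagram ≅ F) :
    WaldhausenFlag I A where
  diagram := F
  isZero i := (D.isZero i).of_iso (e.app _).symm
  mono hij hjk := by
    have := D.mono hij hjk
    rw [← NatIso.naturality_1 e]
    infer_instance
  epi hij hjk := by
    have := D.epi hij hjk
    rw [← NatIso.naturality_1 e]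
    infer_instance
  isPullback hij hjk hkl := (D.isPullback hij hjk hkl).of_iso (e.app _) (e.app _) (e.app _)
    (e.app _) (e.hom.naturality _) (e.hom.naturality _) (e.hom.naturality _) (e.hom.naturality _)
  isPushout hij hjk hkl := (D.isPushout hij hjk hkl).of_iso (e.app _) (e.app _) (e.app _)
    (e.app _) (e.hom.naturality _) (e.hom.naturality _) (e.hom.naturality _) (e.hom.naturality _)

/-! ### Presentations of flags -/

/-- A presentation of a flag as the subquotients of a chain of objects. -/
structure Presentation (D : WaldhausenFlag I A) where
  chain : I ⥤ A
  proj : ∀ {i j : I} (h : i ≤ j), chain.obj j ⟶ D.obj h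
  proj_naturality : ∀ {i j k l : I} (hij : i ≤ j) (hkl : k ≤ l) (hik : i ≤ k) (hjl : j ≤ l),
    chain.map (homOfLE hjl) ≫ proj hkl = proj hij ≫ D.map hij hkl hik hjl
  isPushout : ∀ {i j : I} (h : i ≤ j), IsPushout (chain.map (homOfLE h)) (proj (le_refl i))
    (proj h) (D.map (le_refl i) h le_rfl h)

namespace Presentation

variable {D E : WaldhausenFlag I A}

theorem epi_proj (P : D.Presentation) {i j : I} (h : i ≤ j) : Epi (P.proj h) :=
  (P.isPushout h).epi_inl_of_epi ((D.isZero i).epi_of_tgt _)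

/-- The zero object `Z` is arbitrary because different flags have different zero objects on their
diagonals; composites through any two of them agree. -/
theorem exists_desc (P : D.Presentation) {i j : I} (h : i ≤ j) {X Z : A} (hZ : IsZero Z)
    (f : P.chain.obj j ⟶ X) (u : P.chain.obj i ⟶ Z) (v : Z ⟶ X)
    (w : P.chain.map (homOfLE h) ≫ f = u ≫ v) : ∃ g : D.obj h ⟶ X, P.proj h ≫ g = f :=
  ⟨(P.isPushout h).desc f ((D.isZero i).to_ X)
    (w.trans (hZ.comp_eq_comp (D.isZero i) _ _ _ _)), (P.isPushout h).inl_desc _ _ _⟩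

theorem hom_ext (P : D.Presentation) {F : IntervalPoset I ⥤ A} {φ ψ : D.diagram ⟶ F}
    (H : ∀ {i j : I} (h : i ≤ j), P.proj h ≫ φ.app (IntervalPoset.mk h) =
      P.proj h ≫ ψ.app (IntervalPoset.mk h)) : φ = ψ := by
  ext ⟨⟨i, j⟩, h⟩
  have := P.epi_proj h
  exact (cancel_epi (P.proj h)).1 (H h)

/-- A map of chains descends to the quotients, and naturality can be tested after the epimorphisms
`P.proj`. -/
theorem exists_hom (P : D.Presentation) (R : E.Presentation) (τ : P.chain ⟶ R.chain) :
    ∃ φ : D.diagram ⟶ E.diagram, ∀ {i j : I} (h : i ≤ j),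
      P.proj h ≫ φ.app (IntervalPoset.mk h) = τ.app j ≫ R.proj h := by
  have H : ∀ p : IntervalPoset I, ∃ g : D.diagram.obj p ⟶ E.diagram.obj p,
      P.proj p.2 ≫ g = τ.app p.1.2 ≫ R.proj p.2 := by
    rintro ⟨⟨i, j⟩, h : i ≤ j⟩
    refine P.exists_desc h (E.isZero i) (τ.app j ≫ R.proj h) (τ.app i ≫ R.proj le_rfl)
      (E.map (le_refl i) h le_rfl h) ?_
    rw [NatTrans.naturality_assoc, R.proj_naturality (le_refl i) h le_rfl h, Category.assoc]
  choose g hg using H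
  refine ⟨⟨g, ?_⟩, fun {i j} h => hg ⟨(i, j), h⟩⟩
  rintro ⟨⟨i, j⟩, h : i ≤ j⟩ ⟨⟨k, l⟩, h' : k ≤ l⟩ f
  have hik : i ≤ k := (leOfHom f).1
  have hjl : j ≤ l := (leOfHom f).2
  have := P.epi_proj h
  have e := hg ⟨(i, j), h⟩
  have e' := hg ⟨(k, l), h'⟩
  have n := P.proj_naturality h h' hik hjl
  have n' := R.proj_naturality h h' hik hjl
  have ef : f = IntervalPoset.homMk h h' hik hjl := Subsingleton.elim _ _
  rw [ef, ← cancel_epi (P.proj h), ← reassoc_of% n, reassoc_of% e, ← n', e',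
    NatTrans.naturality_assoc]

theorem exists_iso (P : D.Presentation) (R : E.Presentation) (τ : P.chain ≅ R.chain) :
    ∃ φ : D.diagram ≅ E.diagram, ∀ {i j : I} (h : i ≤ j),
      P.proj h ≫ φ.hom.app (IntervalPoset.mk h) = τ.hom.app j ≫ R.proj h := by
  obtain ⟨φ, hφ⟩ := P.exists_hom R τ.hom
  obtain ⟨ψ, hψ⟩ := R.exists_hom P τ.inv
  refine ⟨⟨φ, ψ, P.hom_ext fun h => ?_, R.hom_ext fun h => ?_⟩, hφ⟩
  · rw [NatTrans.comp_app, reassoc_of% hφ h, hψ h]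
    simp
  · rw [NatTrans.comp_app, reassoc_of% hψ h, hφ h]
    simp

/-- The restriction of a presentation along a monotone map. -/
def restrict {D : WaldhausenFlag J A} (P : D.Presentation) (f : I →o J) :
    (D.restrict f).Presentation where
  chain := f.monotone.functor ⋙ P.chain
  proj h := P.proj (f.monotone h)
  proj_naturality hij hkl hik hjl := P.proj_naturality (f.monotone hij) (f.monotone hkl)
    (f.monotone hik) (f.monotone hjl)
  isPushout h := P.isPushout (f.monotone h)

/-- The presentation obtained by composition with a natural transformation of chains whose
naturality squares are pushouts. -/
def ofPushout (P : D.Presentation) {T : I ⥤ A} (τ : T ⟶ P.chain)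
    (H : ∀ {i j : I} (h : i ≤ j), IsPushout (T.map (homOfLE h)) (τ.app i) (τ.app j)
      (P.chain.map (homOfLE h))) : D.Presentation where
  chain := T
  proj {i j} h := τ.app j ≫ P.proj h
  proj_naturality hij hkl hik hjl := by
    rw [NatTrans.naturality_assoc, P.proj_naturality hij hkl hik hjl, Category.assoc]
  isPushout h := (H h).paste_vert (P.isPushout h)

end Presentation

/-- The presentation of a flag by the objects `A_{o,j}`, for a least element `o`. -/
def basePresentation (D : WaldhausenFlag I A) {o : I} (ho : ∀ i, o ≤ i) : D.Presentation where
  chain :=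
    { obj j := D.obj (ho j)
      map f := D.map _ _ le_rfl (leOfHom f)
      map_id _ := D.map_self _
      map_comp _ _ := (D.map_comp_map _ _ _ _ _ _ _).symm }
  proj {i j} h := D.map (ho j) h (ho i) le_rfl
  proj_naturality hij hkl hik hjl := by
    simp only [map_comp_map]
  isPushout {i j} h := D.isPushout (ho i) (le_refl i) h

/-- Each `A_{o,j}` is a subobject of `A_{o,t}`, and each `A_{i,j}` is a quotient of `A_{o,j}`; so
the component at `A_{o,t}` determines all others. -/
theorem hom_ext {D E : WaldhausenFlag I A} {o t : I} (ho : ∀ i, o ≤ i) (ht : ∀ i, i ≤ t)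
    {φ ψ : D.diagram ⟶ E.diagram}
    (H : φ.app (IntervalPoset.mk (ho t)) = ψ.app (IntervalPoset.mk (ho t))) : φ = ψ := by
  refine (D.basePresentation ho).hom_ext fun {i j} h => ?_
  change D.map (ho j) h (ho i) le_rfl ≫ _ = D.map (ho j) h (ho i) le_rfl ≫ _
  rw [naturality, naturality]
  congr 1
  have := E.mono_map (ho j) (ho t) (ht j)
  rw [← cancel_mono (E.map (ho j) (ho t) le_rfl (ht j)), ← naturality, ← naturality, H]

section

variable [ProtoAbelian A]

/-- The object `D_{i,j}` is the pushout of `T_i ↪ T_j` along `T_i ↠ 0`. Cancellation of pushouts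
makes all squares pushouts, and the proto-abelian axiom makes them pullbacks. -/
theorem exists_presentation (T : I ⥤ A) (hT : ∀ {i j : I} (f : i ⟶ j), Mono (T.map f)) :
    ∃ (D : WaldhausenFlag I A) (P : D.Presentation), P.chain = T := by
  obtain ⟨O, hO⟩ := (ProtoAbelian.hasZeroObject (A := A)).zero
  have H : ∀ p : IntervalPoset I, ∃ (d : A) (h : T.obj p.1.2 ⟶ d) (k : O ⟶ d),
      IsPushout (T.map (homOfLE p.2)) (hO.from_ _) h k := fun p => by
    obtain ⟨d, h, k, -, -, H⟩ := ProtoAbelian.exists_isPushout (T.map (homOfLE p.2))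
      (hO.from_ (T.obj p.1.1)) (hT _) (hO.epi_of_tgt _)
    exact ⟨d, h, k, H⟩
  choose d q z H using H
  have hq : ∀ p, Epi (q p) := fun p => (H p).epi_inl_of_epi (hO.epi_of_tgt _)
  have hm : ∀ (p p' : IntervalPoset I) (f : p ⟶ p'), ∃ g : d p ⟶ d p',
      q p ≫ g = T.map (homOfLE (leOfHom f).2) ≫ q p' := fun p p' f => by
    refine ⟨(H p).desc (T.map (homOfLE (leOfHom f).2) ≫ q p') (z p') ?_, (H p).inl_desc _ _ _⟩
    have e : homOfLE p.2 ≫ homOfLE (leOfHom f).2 = homOfLE (leOfHom f).1 ≫ homOfLE p'.2 :=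
      Subsingleton.elim _ _
    rw [← Functor.map_comp_assoc, e, Functor.map_comp_assoc, (H p').w, ← Category.assoc]
    congr 1
    exact hO.eq_of_tgt _ _
  choose m hm' using hm
  have hm : ∀ {p p' : IntervalPoset I} (f : p ⟶ p'),
      q p ≫ m p p' f = T.map (homOfLE (leOfHom f).2) ≫ q p' := fun f => hm' _ _ f
  let F : IntervalPoset I ⥤ A :=
    { obj := d
      map f := m _ _ f
      map_id p := by
        rw [← cancel_epi (q p), hm]
        exact (by simp : T.map (𝟙 _) ≫ q p = q p ≫ 𝟙 _)
      map_comp {p p' p''} f g := by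
        rw [← cancel_epi (q p), hm, reassoc_of% hm f, hm, ← Functor.map_comp_assoc]
        rfl }
  have hpush : ∀ {i k l : I} (hik : i ≤ k) (hkl : k ≤ l),
      IsPushout (T.map (homOfLE hkl)) (q ⟨(i, k), hik⟩) (q ⟨(i, l), hik.trans hkl⟩)
        (F.map (IntervalPoset.homMk hik (hik.trans hkl) le_rfl hkl)) := fun {i k l} hik hkl => by
    -- The square for `i ≤ l` is the square for `i ≤ k` followed by the desired one; cancel the
    -- first.
    refine IsPushout.of_left (h₁₁ := T.map (homOfLE hik)) (h₂₁ := z ⟨(i, k), hik⟩)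
      (v₁₁ := hO.from_ _) ?_
      (hm (IntervalPoset.homMk hik (hik.trans hkl) le_rfl hkl)).symm (H ⟨(i, k), hik⟩)
    have := H ⟨(i, l), hik.trans hkl⟩
    -- The legs out of `O` were chosen separately for each pair, but any two maps out of a zero
    -- object agree.
    rw [hO.eq_of_src (z ⟨(i, l), hik.trans hkl⟩) (z ⟨(i, k), hik⟩ ≫
      F.map (IntervalPoset.homMk hik (hik.trans hkl) le_rfl hkl))] at this
    rwa [← Functor.map_comp]
  have hmono : ∀ {i k l : I} (hik : i ≤ k) (hkl : k ≤ l),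
      Mono (F.map (IntervalPoset.homMk hik (hik.trans hkl) le_rfl hkl)) := fun hik hkl =>
    ProtoAbelian.mono_of_isPushout (hpush hik hkl) (hT _) (hq _)
  have hepi : ∀ {i j k : I} (hij : i ≤ j) (hjk : j ≤ k),
      Epi (F.map (IntervalPoset.homMk (hij.trans hjk) hjk hij le_rfl)) := fun {i j k} hij hjk => by
    have e := hm (IntervalPoset.homMk (hij.trans hjk) hjk hij le_rfl)
    have e' : q ⟨(i, k), hij.trans hjk⟩ ≫ m _ _ (IntervalPoset.homMk (hij.trans hjk) hjk hij le_rfl) =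
        q ⟨(j, k), hjk⟩ := e.trans ((by simp : T.map (𝟙 _) ≫ q ⟨(j, k), hjk⟩ = _))
    have := hq ⟨(j, k), hjk⟩
    rw [← e'] at this
    exact epi_of_epi (q ⟨(i, k), hij.trans hjk⟩) _
  have hsq : ∀ {i j k l : I} (hij : i ≤ j) (hjk : j ≤ k) (hkl : k ≤ l), IsPushout
      (F.map (IntervalPoset.homMk (hij.trans hjk) (hij.trans (hjk.trans hkl)) le_rfl hkl))
      (F.map (IntervalPoset.homMk (hij.trans hjk) hjk hij le_rfl))
      (F.map (IntervalPoset.homMk (hij.trans (hjk.trans hkl)) (hjk.trans hkl) hij le_rfl))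
      (F.map (IntervalPoset.homMk hjk (hjk.trans hkl) le_rfl hkl)) := fun {i j k l} hij hjk hkl => by
    -- The squares from `T` to `D_{i,-}` and from `T` to `D_{j,-}` are pushouts; cancelling the
    -- former from the latter leaves the square from `D_{i,-}` to `D_{j,-}`.
    refine IsPushout.of_top ?_ ?_ (hpush (hij.trans hjk) hkl)
    · have e : ∀ {n} (hn : j ≤ n), q ⟨(i, n), hij.trans hn⟩ ≫
          F.map (IntervalPoset.homMk (hij.trans hn) hn hij le_rfl) = q ⟨(j, n), hn⟩ :=
        fun {n} hn => (hm (IntervalPoset.homMk (hij.trans hn) hn hij le_rfl)).trans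
          ((by simp : T.map (𝟙 _) ≫ q ⟨(j, n), hn⟩ = _))
      have := hpush hjk hkl
      rw [← e hjk, ← e (hjk.trans hkl)] at this
      exact this
    · rw [← F.map_comp, ← F.map_comp]
      rfl
  refine ⟨⟨F, fun i => ?_, fun hij hjk => hmono hij hjk, fun hij hjk => hepi hij hjk,
    fun hij hjk hkl => ProtoAbelian.isPullback_of_isPushout (hsq hij hjk hkl) (hmono _ _)
      (hepi _ _), fun hij hjk hkl => hsq hij hjk hkl⟩, ⟨T, fun {i j} h => q ⟨(i, j), h⟩, ?_, ?_⟩,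
      rfl⟩
  -- `D_{i,i}` is a pushout along an identity, hence isomorphic to `O`.
  · have : IsIso (z ⟨(i, i), le_rfl⟩) := by
      have e : IsIso (T.map (homOfLE (le_refl i))) :=
        (inferInstance : IsIso (T.map (𝟙 i)))
      exact (H ⟨(i, i), le_rfl⟩).isIso_inr_of_isIso
    exact hO.of_iso (asIso (z ⟨(i, i), le_rfl⟩)).symm
  · exact fun hij hkl hik hjl => (hm (IntervalPoset.homMk hij hkl hik hjl)).symm
  · exact fun h => hpush le_rfl h

end

end WaldhausenFlag

/-! ### Gluing of flags along a diagonal -/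

/-- The monotone maps `α : I → K` and `β : J → K` decompose the polygon `K` along the diagonal
`β a = α ⊥`, `β b = α ⊤` into an inner polygon `I` and an outer polygon `J`. If `I` is a single
point, then `β` is allowed to identify `a` and `b`. -/
structure IsDecomposition {I J K : Type} [PartialOrder I] [BoundedOrder I] [PartialOrder J]
    [BoundedOrder J] [PartialOrder K] (α : I →o K) (β : J →o K) (a b : J) : Prop where
  le : a ≤ b
  outer_bot_le : ∀ k, β ⊥ ≤ k
  le_outer_top : ∀ k, k ≤ β ⊤
  left : β a = α ⊥
  right : β b = α ⊤
  cover : ∀ k, (∃ j, β j = k) ∨ ∃ l, α l = k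
  le_of_inner_le_inner : ∀ {l l'}, α l ≤ α l' → l ≤ l'
  le_of_outer_le_outer : ∀ {j j'}, β j ≤ β j' → j ≤ j' ∨ ((⊤ : I) ≤ ⊥ ∧ j ≤ b ∧ a ≤ j')
  le_of_outer_le_inner : ∀ {j l}, β j ≤ α l → j ≤ a ∨ (⊤ ≤ l ∧ j ≤ b)
  le_of_inner_le_outer : ∀ {l j}, α l ≤ β j → b ≤ j ∨ (l ≤ ⊥ ∧ a ≤ j)

namespace IsDecomposition

variable {I J K : Type} [PartialOrder I] [BoundedOrder I] [PartialOrder J] [BoundedOrder J]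
  [PartialOrder K] {α : I →o K} {β : J →o K} {a b : J}
variable {A : Type u} [Category.{v} A]

theorem inner_le (_ : IsDecomposition α β a b) : α ⊥ ≤ α ⊤ :=
  α.monotone bot_le

theorem outer_le (h : IsDecomposition α β a b) : β a ≤ β b :=
  β.monotone h.le

/-- The long component of `φ` has to preserve every subobject `A_{⊥,k}`. At outer vertices `φ` shows
this. At an inner vertex `α l`, the object `E_{⊥,α l}` is the pullback of `E_{⊥,α ⊤}` and `E_{α ⊥,α
l}` over `E_{α ⊥,α ⊤}`, so `φ` and `ψ` together induce the map; `w` is the compatibility this needs.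
-/
theorem exists_hom (h : IsDecomposition α β a b) {D E : WaldhausenFlag K A}
    (φ : (D.restrict β).diagram ⟶ (E.restrict β).diagram)
    (ψ : (D.restrict α).diagram ⟶ (E.restrict α).diagram)
    (w : WaldhausenFlag.restrictApp φ h.le h.outer_le ≫
        E.map h.outer_le h.inner_le h.left.le h.right.le =
      D.map h.outer_le h.inner_le h.left.le h.right.le ≫
        WaldhausenFlag.restrictApp ψ (bot_le : (⊥ : I) ≤ ⊤) h.inner_le) :
    ∃ Φ : D.diagram ⟶ E.diagram, Functor.whiskerLeft (IntervalPoset.map β) Φ = φ ∧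
      Functor.whiskerLeft (IntervalPoset.map α) Φ = ψ := by
  have hα : ∀ {l l' : I}, l ≤ l' → α l ≤ α l' := fun h => α.monotone h
  have hβ : ∀ {j j' : J}, j ≤ j' → β j ≤ β j' := fun h => β.monotone h
  have key : ∀ k, ∃ f : D.obj (h.outer_bot_le k) ⟶ E.obj (h.outer_bot_le k),
      f ≫ E.map (h.outer_bot_le k) (h.outer_bot_le _) le_rfl (h.le_outer_top k) =
        D.map (h.outer_bot_le k) (h.outer_bot_le _) le_rfl (h.le_outer_top k) ≫
          WaldhausenFlag.restrictApp φ (bot_le : (⊥ : J) ≤ ⊤) (h.outer_bot_le _) := fun k => by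
    rcases h.cover k with ⟨j, rfl⟩ | ⟨l, rfl⟩
    · exact ⟨WaldhausenFlag.restrictApp φ (bot_le : ⊥ ≤ j) (h.outer_bot_le _),
        (WaldhausenFlag.restrictApp_naturality φ _ _ _ _ le_rfl le_top _ _).symm⟩
    · have hl : α l ≤ β b := h.right.symm ▸ hα le_top
      have hl' : α l ≤ α ⊤ := hα le_top
      have hl'' : α ⊥ ≤ α l := hα bot_le
      have sq := E.isPullback (h.outer_bot_le (α ⊥)) hl'' hl'
      have nφ := WaldhausenFlag.restrictApp_naturality φ (bot_le : ⊥ ≤ b) h.le (h.outer_bot_le _)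
        h.outer_le bot_le le_rfl (h.outer_bot_le _) le_rfl
      have nφ' := WaldhausenFlag.restrictApp_naturality φ (bot_le : ⊥ ≤ b)
        (bot_le : ⊥ ≤ ⊤) (h.outer_bot_le _) (h.outer_bot_le _) le_rfl le_top le_rfl (h.le_outer_top _)
      have nψ := WaldhausenFlag.restrictApp_naturality ψ (bot_le : ⊥ ≤ l)
        (bot_le : ⊥ ≤ ⊤) hl'' h.inner_le le_rfl le_top le_rfl hl'
      -- `φ` has components only at outer indices, so the map passes through `β b`, which equals `α
      -- ⊤` only propositionally.
      let u : D.obj (h.outer_bot_le (α l)) ⟶ E.obj (h.outer_bot_le (α ⊤)) :=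
        D.map (h.outer_bot_le _) (h.outer_bot_le _) le_rfl hl ≫
        WaldhausenFlag.restrictApp φ (bot_le : ⊥ ≤ b) (h.outer_bot_le _) ≫
          E.map (h.outer_bot_le _) (h.outer_bot_le _) le_rfl h.right.le
      have hu : u ≫ E.map (h.outer_bot_le _) h.inner_le (h.outer_bot_le _) le_rfl =
          (D.map _ hl'' (h.outer_bot_le _) le_rfl ≫
          WaldhausenFlag.restrictApp ψ (bot_le : ⊥ ≤ l) hl'') ≫
          E.map hl'' h.inner_le le_rfl hl' := by
        simp only [u, Category.assoc, WaldhausenFlag.map_comp_map]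
        rw [← nψ, WaldhausenFlag.map_comp_map_assoc,
          ← E.map_comp_map (h.outer_bot_le _) h.outer_le h.inner_le
            (h.outer_bot_le _) le_rfl h.left.le h.right.le, ← reassoc_of% nφ, w,
          WaldhausenFlag.map_comp_map_assoc, WaldhausenFlag.map_comp_map_assoc]
      refine ⟨sq.lift u _ hu, ?_⟩
      rw [← E.map_comp_map (h.outer_bot_le (α l)) (h.outer_bot_le (α ⊤)) (h.outer_bot_le (β ⊤)) le_rfl hl' le_rfl
        (h.le_outer_top _), IsPullback.lift_fst_assoc]
      simp only [u, Category.assoc, WaldhausenFlag.map_comp_map]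
      rw [← nφ', WaldhausenFlag.map_comp_map_assoc]
  choose f hf using key
  have hmono : ∀ k, Mono (E.map (h.outer_bot_le k) (h.outer_bot_le _) le_rfl (h.le_outer_top k)) :=
    fun k => E.mono_map _ _ _
  have hnat : ∀ {k k' : K} (hk : k ≤ k'), D.map (h.outer_bot_le k) (h.outer_bot_le k') le_rfl hk ≫ f k' =
      f k ≫ E.map (h.outer_bot_le k) (h.outer_bot_le k') le_rfl hk := fun {k k'} hk => by
    have := hmono k'
    rw [← cancel_mono (E.map (h.outer_bot_le k') (h.outer_bot_le (β ⊤)) le_rfl (h.le_outer_top k')),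
      Category.assoc, hf, Category.assoc, WaldhausenFlag.map_comp_map, hf,
      WaldhausenFlag.map_comp_map_assoc]
  obtain ⟨Φ, hΦ⟩ := (D.basePresentation h.outer_bot_le).exists_hom (E.basePresentation h.outer_bot_le)
    { app := f
      naturality := fun k k' g => hnat (leOfHom g) }
  have hΦ' : Φ.app (IntervalPoset.mk (h.outer_bot_le (β ⊤))) =
      WaldhausenFlag.restrictApp φ (bot_le : (⊥ : J) ≤ ⊤) (h.outer_bot_le _) := by
    have e1 : D.map (h.outer_bot_le _) (h.outer_bot_le _) le_rfl le_rfl ≫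
      Φ.app (IntervalPoset.mk (h.outer_bot_le (β ⊤))) =
        f (β ⊤) ≫ E.map (h.outer_bot_le (β ⊤)) (h.outer_bot_le (β ⊤)) le_rfl (h.le_outer_top (β ⊤)) :=
      hΦ (h.outer_bot_le (β ⊤))
    rw [hf, WaldhausenFlag.map_self] at e1
    simpa only [Category.id_comp] using e1
  have hΦβ : Functor.whiskerLeft (IntervalPoset.map β) Φ = φ :=
    WaldhausenFlag.hom_ext (D := D.restrict β) (E := E.restrict β) (fun _ => bot_le)
      (fun _ => le_top) hΦ'
  refine ⟨Φ, hΦβ, WaldhausenFlag.hom_ext (D := D.restrict α) (E := E.restrict α)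
    (fun _ => bot_le) (fun _ => le_top) ?_⟩
  have hab : Φ.app (IntervalPoset.mk h.outer_le) =
      WaldhausenFlag.restrictApp φ h.le h.outer_le := by
    rw [← hΦβ]
    rfl
  -- The long component of `ψ` is forced by that of `φ` at `(a, b)`, because the structure map
  -- between the two copies of the diagonal is invertible.
  have e : Φ.app (IntervalPoset.mk h.inner_le) =
      WaldhausenFlag.restrictApp ψ (bot_le : (⊥ : I) ≤ ⊤) h.inner_le := by
    have := D.isIso_map h.outer_le h.inner_le h.left.le h.right.le h.left.ge h.right.ge
    rw [← cancel_epi (D.map h.outer_le h.inner_le h.left.le h.right.le), ← w, ← hab]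
    exact WaldhausenFlag.naturality Φ _ _ _ _
  exact e

theorem exists_iso (h : IsDecomposition α β a b) {D E : WaldhausenFlag K A}
    (φ : (D.restrict β).diagram ≅ (E.restrict β).diagram)
    (ψ : (D.restrict α).diagram ≅ (E.restrict α).diagram)
    (w : WaldhausenFlag.restrictApp φ.hom h.le h.outer_le ≫
        E.map h.outer_le h.inner_le h.left.le h.right.le =
      D.map h.outer_le h.inner_le h.left.le h.right.le ≫
        WaldhausenFlag.restrictApp ψ.hom (bot_le : (⊥ : I) ≤ ⊤) h.inner_le) :
    ∃ Φ : D.diagram ≅ E.diagram, Functor.isoWhiskerLeft (IntervalPoset.map β) Φ = φ ∧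
      Functor.isoWhiskerLeft (IntervalPoset.map α) Φ = ψ := by
  obtain ⟨Φ, hβ, hα⟩ := h.exists_hom φ.hom ψ.hom w
  obtain ⟨Ψ, hβ', -⟩ := h.exists_hom φ.inv ψ.inv (by
    have e1 : WaldhausenFlag.restrictApp φ.inv h.le h.outer_le ≫
        WaldhausenFlag.restrictApp φ.hom h.le h.outer_le = 𝟙 _ := φ.inv_hom_id_app _
    have e2 : WaldhausenFlag.restrictApp ψ.hom (bot_le : (⊥ : I) ≤ ⊤) h.inner_le ≫
        WaldhausenFlag.restrictApp ψ.inv (bot_le : (⊥ : I) ≤ ⊤) h.inner_le = 𝟙 _ :=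
      ψ.hom_inv_id_app _
    have := WaldhausenFlag.restrictApp φ.inv h.le h.outer_le ≫= w =≫
      WaldhausenFlag.restrictApp ψ.inv (bot_le : (⊥ : I) ≤ ⊤) h.inner_le
    simp only [Category.assoc] at this
    rw [reassoc_of% e1, e2, Category.comp_id] at this
    exact this.symm)
  refine ⟨⟨Φ, Ψ, ?_, ?_⟩, Iso.ext hβ, Iso.ext hα⟩
  · refine WaldhausenFlag.hom_ext h.outer_bot_le h.le_outer_top ?_
    have := congr_app (φ.hom_inv_id) (IntervalPoset.mk (bot_le : (⊥ : J) ≤ ⊤))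
    rw [← hβ, ← hβ'] at this
    exact this
  · refine WaldhausenFlag.hom_ext h.outer_bot_le h.le_outer_top ?_
    have := congr_app (φ.inv_hom_id) (IntervalPoset.mk (bot_le : (⊥ : J) ≤ ⊤))
    rw [← hβ, ← hβ'] at this
    exact this

end IsDecomposition

/-! ### Chains of subobjects -/

section

variable {I J K : Type} [Preorder I] [Preorder J] [Preorder K] {A : Type u} [Category.{v} A]

/-- Two chains of subobjects of `X` that are pointwise equal as subobjects are isomorphic. -/
theorem exists_natIso_of_subobjects {X : A} {F G : I ⥤ A} (s : ∀ i, F.obj i ⟶ X)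
    (t : ∀ i, G.obj i ⟶ X) (hs : ∀ i, Mono (s i)) (ht : ∀ i, Mono (t i))
    (ns : ∀ {i j} (f : i ⟶ j), F.map f ≫ s j = s i)
    (nt : ∀ {i j} (f : i ⟶ j), G.map f ≫ t j = t i)
    (H : ∀ i, ∃ f : F.obj i ⟶ G.obj i, f ≫ t i = s i)
    (H' : ∀ i, ∃ f : G.obj i ⟶ F.obj i, f ≫ s i = t i) :
    ∃ e : F ≅ G, ∀ i, e.hom.app i ≫ t i = s i := by
  choose f hf using H
  choose g hg using H'
  refine ⟨NatIso.ofComponents (fun i => ⟨f i, g i, ?_, ?_⟩) (fun {i j} u => ?_), fun i => hf i⟩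
  · rw [← cancel_mono (s i), Category.assoc, hg, hf, Category.id_comp]
  · rw [← cancel_mono (t i), Category.assoc, hf, hg, Category.id_comp]
  · rw [← cancel_mono (t j), Category.assoc, hf, ns, Category.assoc, nt, hf]

/-- Two chains of subobjects of `X` can be merged into one. -/
theorem exists_merged_chain {α : I →o K} {β : J →o K}
    (cover : ∀ k, (∃ j, β j = k) ∨ ∃ l, α l = k) {X : A}
    (F : J ⥤ A) (s : ∀ j, F.obj j ⟶ X) (hs : ∀ j, Mono (s j))
    (ns : ∀ {i j} (f : i ⟶ j), F.map f ≫ s j = s i)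
    (G : I ⥤ A) (t : ∀ l, G.obj l ⟶ X) (ht : ∀ l, Mono (t l))
    (nt : ∀ {i j} (f : i ⟶ j), G.map f ≫ t j = t i)
    (hFF : ∀ j j', β j ≤ β j' → ∃ f : F.obj j ⟶ F.obj j', f ≫ s j' = s j)
    (hFG : ∀ j l, β j ≤ α l → ∃ f : F.obj j ⟶ G.obj l, f ≫ t l = s j)
    (hGF : ∀ l j, α l ≤ β j → ∃ f : G.obj l ⟶ F.obj j, f ≫ s j = t l)
    (hGG : ∀ l l', α l ≤ α l' → ∃ f : G.obj l ⟶ G.obj l', f ≫ t l' = t l) :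
    ∃ (T : K ⥤ A) (r : ∀ k, T.obj k ⟶ X) (e : β.monotone.functor ⋙ T ≅ F)
      (e' : α.monotone.functor ⋙ T ≅ G), (∀ {k k'} (f : k ⟶ k'), Mono (T.map f)) ∧
        (∀ {k k'} (f : k ⟶ k'), T.map f ≫ r k' = r k) ∧
        (∀ j, e.hom.app j ≫ s j = r (β j)) ∧ (∀ l, e'.hom.app l ≫ t l = r (α l)) := by
  -- Each `k` gets one representative `σ k` among the objects over it. Two representatives of the
  -- same `k` factor through each other, and functoriality is automatic since all maps are
  -- compatible with monomorphisms into `X`.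
  let S : J ⊕ I → A := Sum.elim F.obj G.obj
  let r : ∀ c, S c ⟶ X := fun c => match c with
    | Sum.inl j => s j
    | Sum.inr l => t l
  have hr : ∀ c, Mono (r c) := fun c => match c with
    | Sum.inl j => hs j
    | Sum.inr l => ht l
  let π : J ⊕ I → K := Sum.elim β α
  have fac : ∀ c c', π c ≤ π c' → ∃ f : S c ⟶ S c', f ≫ r c' = r c := fun c c' => match c, c' with
    | Sum.inl j, Sum.inl j' => hFF j j'
    | Sum.inl j, Sum.inr l => hFG j l
    | Sum.inr l, Sum.inl j => hGF l j
    | Sum.inr l, Sum.inr l' => hGG l l'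
  have hπ : ∀ k, ∃ c, π c = k := fun k => (cover k).elim (fun ⟨j, hj⟩ => ⟨Sum.inl j, hj⟩)
    (fun ⟨l, hl⟩ => ⟨Sum.inr l, hl⟩)
  choose M hM using fac
  choose σ hσ using hπ
  have ext : ∀ {c c'} (g g' : S c ⟶ S c'), g ≫ r c' = g' ≫ r c' → g = g' := fun {c c'} g g' e => by
    have := hr c'
    exact (cancel_mono (r c')).1 e
  let T : K ⥤ A :=
    { obj k := S (σ k)
      map {k k'} g := M (σ k) (σ k') (by rw [hσ, hσ]; exact leOfHom g)
      map_id k := ext _ _ (by rw [hM, Category.id_comp])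
      map_comp g g' := ext _ _ (by rw [hM, Category.assoc, hM, hM]) }
  have nT : ∀ {k k'} (f : k ⟶ k'), T.map f ≫ r (σ k') = r (σ k) := fun f => hM _ _ _
  obtain ⟨e, he⟩ := exists_natIso_of_subobjects (F := β.monotone.functor ⋙ T) (G := F)
    (fun j => r (σ (β j))) s (fun j => hr _) hs (fun f => nT (homOfLE (β.monotone (leOfHom f)))) ns
    (fun j => ⟨M (σ (β j)) (Sum.inl j) (hσ _).le, hM _ _ _⟩)
    (fun j => ⟨M (Sum.inl j) (σ (β j)) (hσ _).ge, hM _ _ _⟩)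
  obtain ⟨e', he'⟩ := exists_natIso_of_subobjects (F := α.monotone.functor ⋙ T) (G := G)
    (fun l => r (σ (α l))) t (fun l => hr _) ht (fun f => nT (homOfLE (α.monotone (leOfHom f)))) nt
    (fun l => ⟨M (σ (α l)) (Sum.inr l) (hσ _).le, hM _ _ _⟩)
    (fun l => ⟨M (Sum.inr l) (σ (α l)) (hσ _).ge, hM _ _ _⟩)
  refine ⟨T, fun k => r (σ k), e, e', fun {k k'} f => ?_, nT, he, he'⟩
  have := hr (σ k)
  rw [← nT f] at this
  exact mono_of_mono _ (r (σ k'))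

end

namespace WaldhausenFlag

variable {I : Type} [PartialOrder I] [BoundedOrder I] {A : Type u} [Category.{v} A]
  [ProtoAbelian A]

/-- Presentation of a flag by the preimages of the `D_{⊥,l}` under an epimorphism to `D_{⊥,⊤}`. -/
theorem exists_pullback_presentation (D : WaldhausenFlag I A) {Y : A}
    (p : Y ⟶ D.obj (bot_le : (⊥ : I) ≤ ⊤)) (hp : Epi p) :
    ∃ (P : D.Presentation) (x : ∀ l, P.chain.obj l ⟶ Y)
      (y : ∀ l, P.chain.obj l ⟶ D.obj (bot_le : ⊥ ≤ l)),
      (∀ l, Mono (x l)) ∧ (∀ {l l'} (f : l ⟶ l'), P.chain.map f ≫ x l' = x l) ∧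
      (∀ l, IsPullback (x l) (y l) p (D.map bot_le bot_le le_rfl le_top)) ∧
      ∀ {l l'} (h : l ≤ l'), P.proj h = y l' ≫ D.map bot_le h bot_le le_rfl := by
  have hm : ∀ l, Mono (D.map (bot_le : ⊥ ≤ l) bot_le le_rfl le_top) :=
    fun l => D.mono_map _ _ _
  have hT : ∀ l : I, ∃ (t : A) (x : t ⟶ Y) (y : t ⟶ D.obj (bot_le : ⊥ ≤ l)),
      IsPullback x y p (D.map bot_le bot_le le_rfl le_top) := fun l => by
    obtain ⟨t, x, y, -, -, H⟩ := ProtoAbelian.exists_isPullback p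
      (D.map (bot_le : ⊥ ≤ l) bot_le le_rfl le_top) hp (hm l)
    exact ⟨t, x, y, H⟩
  choose t x y ht using hT
  have hx : ∀ l, Mono (x l) := fun l => (ht l).mono_fst_of_mono
  have hy : ∀ l, Epi (y l) := fun l => ProtoAbelian.epi_of_isPullback (ht l) hp (hm l)
  have fac : ∀ l l' : I, l ≤ l' → ∃ f : t l ⟶ t l', f ≫ x l' = x l := fun l l' hl =>
    ⟨(ht l').lift (x l) (y l ≫ D.map bot_le bot_le le_rfl hl)
      (by rw [(ht l).w, Category.assoc, D.map_comp_map]), IsPullback.lift_fst _ _ _ _⟩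
  choose M hM using fac
  have sq : ∀ l l' (hl : l ≤ l'), M l l' hl ≫ y l' = y l ≫ D.map bot_le bot_le le_rfl hl :=
    fun l l' hl => by
      have := hm l'
      rw [← cancel_mono (D.map (bot_le : ⊥ ≤ l') bot_le le_rfl le_top), Category.assoc,
        ← (ht l').w, reassoc_of% hM, (ht l).w, Category.assoc, D.map_comp_map]
  let T : I ⥤ A :=
    { obj := t
      map {l l'} g := M l l' (leOfHom g)
      map_id l := by rw [← cancel_mono (x l), hM, Category.id_comp]
      map_comp {l l' l''} g g' := by rw [← cancel_mono (x l''), hM, Category.assoc, hM, hM] }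
  let τ : T ⟶ (D.basePresentation (fun _ => bot_le)).chain :=
    { app := y
      naturality l l' g := sq l l' (leOfHom g) }
  refine ⟨(D.basePresentation (fun _ => bot_le)).ofPushout τ fun {l l'} hl => ?_, x, y, hx,
    fun g => hM _ _ _, ht, fun h => rfl⟩
  -- The preimages at `l` and `l'` are both pullbacks of `p`, so the square between them is a
  -- pullback by cancellation, and therefore a pushout.
  have hpb : IsPullback (M l l' hl) (y l) (y l') (D.map bot_le bot_le le_rfl hl) := by
    refine IsPullback.of_right ?_ (sq l l' hl) (ht l')
    rw [hM, D.map_comp_map]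
    exact ht l
  exact ProtoAbelian.isPushout_of_isPullback hpb (hy l') (D.mono_map _ _ _)

end WaldhausenFlag

namespace IsDecomposition

variable {I J K : Type} [PartialOrder I] [BoundedOrder I] [PartialOrder J] [BoundedOrder J]
  [PartialOrder K] {α : I →o K} {β : J →o K} {a b : J}
variable {A : Type u} [Category.{v} A]

/-- The preimages of the `D'_{⊥,l}` under `p : D_{⊥,b} ↠ D_{a,b} ≅ D'_{⊥,⊤}` run from `D_{⊥,a}` to
`D_{⊥,b}`. Merged with the `D_{⊥,j}` inside `D_{⊥,⊤}`, they form a chain indexed by `K`. Its flag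
restricts to `D` and `D'`, since these are presented by the two parts of the chain. -/
theorem exists_glue [ProtoAbelian A] (h : IsDecomposition α β a b) (D : WaldhausenFlag J A)
    (D' : WaldhausenFlag I A) (θ : D.obj h.le ≅ D'.obj (bot_le : (⊥ : I) ≤ ⊤)) :
    ∃ (E : WaldhausenFlag K A) (φ : (E.restrict β).diagram ≅ D.diagram)
      (ψ : (E.restrict α).diagram ≅ D'.diagram),
      WaldhausenFlag.ofRestrictApp φ.hom h.le h.outer_le ≫ θ.hom =
        E.map h.outer_le h.inner_le h.left.le h.right.le ≫
          WaldhausenFlag.ofRestrictApp ψ.hom (bot_le : (⊥ : I) ≤ ⊤) h.inner_le := by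
  obtain ⟨p, hpd⟩ : ∃ p, p = D.map (bot_le : ⊥ ≤ b) h.le bot_le le_rfl ≫ θ.hom := ⟨_, rfl⟩
  have hp : Epi p := by
    have := D.epi_map bot_le h.le (bot_le : ⊥ ≤ a)
    rw [hpd]
    exact epi_comp _ _
  obtain ⟨P', x, y, hx, nx, ht, hproj⟩ := D'.exists_pullback_presentation p hp
  have hmm : ∀ {j j' : J} (hj : j ≤ j'), D.map bot_le bot_le le_rfl hj ≫
      D.map (bot_le : ⊥ ≤ j') bot_le le_rfl le_top =
        D.map (bot_le : ⊥ ≤ j) bot_le le_rfl le_top :=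
    fun hj => D.map_comp_map _ _ _ _ _ _ _
  have hm : ∀ j, Mono (D.map (bot_le : ⊥ ≤ j) bot_le le_rfl le_top) := fun j => D.mono_map _ _ _
  -- If `I` is a point, `β` may identify `a` and `b`. Then `D_{a,b}` is zero, so `D_{⊥,a}` and
  -- `D_{⊥,b}` are the same subobject.
  have hab : (⊤ : I) ≤ ⊥ → ∃ f : D.obj (bot_le : ⊥ ≤ b) ⟶ D.obj (bot_le : ⊥ ≤ a),
      f ≫ D.map bot_le bot_le le_rfl h.le = 𝟙 _ := fun hI => by
    have hz : IsZero (D.obj h.le) := (D'.isZero_obj bot_le hI).of_iso θ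
    exact ⟨(D.isPullback (bot_le : ⊥ ≤ a) le_rfl h.le).lift (𝟙 _) ((D.isZero a).from_ _)
      (hz.eq_of_tgt _ _), IsPullback.lift_fst _ _ _ _⟩
  have hFF : ∀ j j', β j ≤ β j' → ∃ f : D.obj (bot_le : ⊥ ≤ j) ⟶ D.obj (bot_le : ⊥ ≤ j'),
      f ≫ D.map (bot_le : ⊥ ≤ j') bot_le le_rfl le_top =
        D.map (bot_le : ⊥ ≤ j) bot_le le_rfl le_top := fun j j' hj => by
    rcases h.le_of_outer_le_outer hj with hj | ⟨hI, hj, hj'⟩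
    · exact ⟨D.map bot_le bot_le le_rfl hj, hmm hj⟩
    · obtain ⟨f, hf⟩ := hab hI
      refine ⟨D.map bot_le bot_le le_rfl hj ≫ f ≫ D.map bot_le bot_le le_rfl hj', ?_⟩
      rw [Category.assoc, Category.assoc, hmm hj', ← hmm h.le, reassoc_of% hf, hmm hj]
  have hFG : ∀ j l, β j ≤ α l → ∃ f : D.obj (bot_le : ⊥ ≤ j) ⟶ P'.chain.obj l,
      f ≫ x l ≫ D.map (bot_le : ⊥ ≤ b) bot_le le_rfl le_top =
        D.map (bot_le : ⊥ ≤ j) bot_le le_rfl le_top := fun j l hj => by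
    rcases h.le_of_outer_le_inner hj with hj | ⟨hl, hj⟩
    -- For `j ≤ a`, the map `D_{⊥,j} ⟶ D_{a,b}` passes through `D_{a,a} = 0`, so `D_{⊥,j}` lies in
    -- every preimage.
    · have w : D.map bot_le bot_le le_rfl (hj.trans h.le) ≫ p =
          (D.map bot_le (le_refl a) bot_le hj ≫
            (D.isZero a).to_ (D'.obj (bot_le : ⊥ ≤ l))) ≫
              D'.map bot_le bot_le le_rfl le_top := by
        rw [hpd, D.map_comp_map_assoc, ← D.map_comp_map_assoc (bot_le : ⊥ ≤ j) (le_refl a) h.le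
          bot_le hj le_rfl h.le, Category.assoc]
        congr 1
        exact (D.isZero a).eq_of_src _ _
      exact ⟨(ht l).lift _ _ w, by rw [IsPullback.lift_fst_assoc, hmm]⟩
    -- The preimage of all of `D'_{⊥,⊤}` is all of `D_{⊥,b}`.
    · have : IsIso (D'.map (bot_le : ⊥ ≤ l) bot_le le_rfl le_top) :=
        D'.isIso_map _ _ _ _ le_rfl hl
      have : IsIso (x l) := (ht l).isIso_fst_of_isIso
      refine ⟨D.map bot_le bot_le le_rfl hj ≫ inv (x l), ?_⟩
      rw [Category.assoc, IsIso.inv_hom_id_assoc, hmm]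
  have hGF : ∀ l j, α l ≤ β j → ∃ f : P'.chain.obj l ⟶ D.obj (bot_le : ⊥ ≤ j),
      f ≫ D.map (bot_le : ⊥ ≤ j) bot_le le_rfl le_top =
        x l ≫ D.map (bot_le : ⊥ ≤ b) bot_le le_rfl le_top := fun l j hj => by
    rcases h.le_of_inner_le_outer hj with hj | ⟨hl, hj⟩
    · exact ⟨x l ≫ D.map bot_le bot_le le_rfl hj, by rw [Category.assoc, hmm]⟩
    -- The preimage of zero lies in the kernel `D_{⊥,a}` of `D_{⊥,b} ↠ D_{a,b}`.
    · have hz : IsZero (D'.obj (bot_le : ⊥ ≤ l)) := D'.isZero_obj _ hl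
      have w : x l ≫ D.map bot_le h.le bot_le le_rfl =
          (y l ≫ (hz.to_ _)) ≫ D.map (le_refl a) h.le le_rfl h.le := by
        rw [← cancel_mono θ.hom, Category.assoc, ← hpd, (ht l).w, Category.assoc, Category.assoc]
        congr 1
        exact hz.eq_of_src _ _
      refine ⟨(D.isPullback (bot_le : ⊥ ≤ a) le_rfl h.le).lift _ _ w ≫
        D.map bot_le bot_le le_rfl hj, ?_⟩
      rw [Category.assoc, hmm, ← hmm h.le, IsPullback.lift_fst_assoc]
  obtain ⟨T, r, e, e', hT, nT, he, he'⟩ := exists_merged_chain h.cover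
    (D.basePresentation (fun _ => bot_le)).chain
    (fun j => D.map (bot_le : ⊥ ≤ j) bot_le le_rfl le_top) hm
    (fun f => hmm (leOfHom f)) P'.chain
    (fun l => x l ≫ D.map (bot_le : ⊥ ≤ b) bot_le le_rfl le_top)
    (fun l => by
      have := hm b
      have := hx l
      exact mono_comp _ _)
    (fun f => by rw [reassoc_of% nx]) hFF hFG hGF
    (fun l l' hl => ⟨P'.chain.map (homOfLE (h.le_of_inner_le_inner hl)), by rw [reassoc_of% nx]⟩)
  obtain ⟨E, P, rfl⟩ := WaldhausenFlag.exists_presentation T hT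
  obtain ⟨φ, hφ⟩ := (P.restrict β).exists_iso (D.basePresentation (fun _ => bot_le)) e
  obtain ⟨ψ, hψ⟩ := (P.restrict α).exists_iso P' e'
  refine ⟨E, φ, ψ, ?_⟩
  have := P.epi_proj h.outer_le
  obtain ⟨f, h1, hf⟩ : ∃ f : P.chain.obj (β b) ⟶ D.obj (bot_le : ⊥ ≤ b),
      P.proj h.outer_le ≫ WaldhausenFlag.ofRestrictApp φ.hom h.le h.outer_le =
        f ≫ D.map bot_le h.le bot_le le_rfl ∧
      f ≫ D.map (bot_le : ⊥ ≤ b) bot_le le_rfl le_top = r (β b) := ⟨e.hom.app b, hφ h.le, he b⟩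
  obtain ⟨g, h2, hg⟩ : ∃ g : P.chain.obj (α ⊤) ⟶ P'.chain.obj ⊤,
      P.proj h.inner_le ≫ WaldhausenFlag.ofRestrictApp ψ.hom bot_le h.inner_le =
        g ≫ P'.proj bot_le ∧
      g ≫ x ⊤ ≫ D.map (bot_le : ⊥ ≤ b) bot_le le_rfl le_top = r (α ⊤) :=
    ⟨e'.hom.app ⊤, hψ bot_le, he' ⊤⟩
  -- Both sides have the same composite into `D_{⊥,⊤}`. The isomorphism `θ` then enters through `x ⊤
  -- ≫ p = P'.proj bot_le`.
  have h3 : f = P.chain.map (homOfLE h.right.le) ≫ g ≫ x ⊤ := by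
    have := hm b
    rw [← cancel_mono (D.map (bot_le : ⊥ ≤ b) bot_le le_rfl le_top), hf,
      ← nT (homOfLE h.right.le), ← hg]
    simp only [Category.assoc]
  have h4 : x ⊤ ≫ p = P'.proj bot_le := (ht ⊤).w.trans (hproj bot_le).symm
  rw [← cancel_epi (P.proj h.outer_le), reassoc_of% h1,
    ← reassoc_of% P.proj_naturality h.outer_le h.inner_le h.left.le h.right.le, h2, h3, ← h4, ← hpd]
  simp only [Category.assoc]

end IsDecomposition

/-! ### Quotient data -/

namespace QuotientDatum

variable {A : Type u} [Category.{v} A] (Q : QuotientDatum A)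

/-- The factorizations `e ≫ 𝟙` and `𝟙 ≫ e` of `e` both lie in `Q`, and `e⁻¹` is the compatible
isomorphism between their middle objects. -/
theorem inv_mem {x y : A} (e : x ≅ y) (h : Q.hom e.hom) : Q.hom e.inv := by
  refine Q.iso_mem e.hom (𝟙 y) e.symm inferInstance inferInstance h
    (Q.id_mem _ (Q.target_mem _ h)) ?_ ?_
  · rw [Iso.symm_hom, e.hom_inv_id]
    exact Q.id_mem _ (Q.source_mem _ h)
  · rwa [Iso.symm_inv, Category.comp_id]

/-- Induction from the top: the largest object is replaced by some `z` using the factorization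
axiom, and the smaller ones then factor the morphism from `x` to `z`, which is in `Q`. Taking `z` as
the new target puts the transition maps into `z` in `Q`; hence `y` must stay arbitrary in the
induction. -/
theorem exists_chain_mem {I : Type} [LinearOrder I] (G : I ⥤ A) {x : A} (p : ∀ i, x ⟶ G.obj i)
    (hp : ∀ i, Epi (p i)) (np : ∀ {i j} (f : i ⟶ j), p i ≫ G.map f = p j) (s : Finset I) :
    ∀ {y : A} (r : ∀ i ∈ s, G.obj i ⟶ y), (∀ i hi, Epi (r i hi)) →
      (∀ {i j} (hi : i ∈ s) (hj : j ∈ s) (f : i ⟶ j), G.map f ≫ r j hj = r i hi) →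
      (∀ i hi, Q.hom (p i ≫ r i hi)) →
      ∃ F : ∀ i, Σ z : A, G.obj i ≅ z, (∀ i ∈ s, Q.hom (p i ≫ (F i).2.hom)) ∧
        (∀ i hi, Q.hom ((F i).2.inv ≫ r i hi)) ∧
        ∀ {i j}, i ∈ s → j ∈ s → ∀ f : i ⟶ j, Q.hom ((F i).2.inv ≫ G.map f ≫ (F j).2.hom) := by
  induction s using Finset.induction_on_max with
  | empty =>
    intro y r _ _ _
    exact ⟨fun i => ⟨_, Iso.refl _⟩, by simp, by simp, by simp⟩
  | insert a s ha ih =>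
    intro y r hr nr hpr
    have haS : a ∈ insert a s := Finset.mem_insert_self _ _
    obtain ⟨z, e, he, he'⟩ := Q.exists_factorization (p a) (r a haS) (hp a) (hr a haS) (hpr a haS)
    have hepi : ∀ {i} (hi : i ∈ s), Epi (G.map (homOfLE (ha i hi).le)) := fun {i} hi => by
      have := hp a
      rw [← np (homOfLE (ha i hi).le)] at this
      exact epi_of_epi (p i) _
    obtain ⟨F, h1, h2, h3⟩ := ih (fun i hi => G.map (homOfLE (ha i hi).le) ≫ e.hom)
      (fun i hi => by
        have := hepi hi
        exact epi_comp _ _)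
      (fun hi hj f => by
        rw [← Category.assoc, ← G.map_comp]
        rfl)
      (fun i hi => by rwa [← Category.assoc, np])
    let F' : ∀ i, Σ z : A, G.obj i ≅ z := Function.update F a ⟨z, e⟩
    have hF'a : F' a = ⟨z, e⟩ := Function.update_self _ _ _
    have hF's : ∀ i ∈ s, F' i = F i := fun i hi => Function.update_of_ne (ha i hi).ne _ _
    refine ⟨F', fun i hi => ?_, fun i hi => ?_, fun {i j} hi hj f => ?_⟩
    · rcases Finset.mem_insert.1 hi with rfl | hi
      · rwa [hF'a]
      · rw [hF's i hi]
        exact h1 i hi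
    · rcases Finset.mem_insert.1 hi with rfl | his
      · rwa [hF'a]
      · rw [hF's i his]
        -- The map to `y` is the map to `z` followed by `z ⟶ y`.
        have := Q.comp_mem _ _ (h2 i his) he'
        simp only [Category.assoc, Iso.hom_inv_id_assoc] at this
        rwa [nr hi haS] at this
    · rcases Finset.mem_insert.1 hi with rfl | his <;> rcases Finset.mem_insert.1 hj with rfl | hjs
      · rw [hF'a, show f = 𝟙 _ from Subsingleton.elim _ _, G.map_id, Category.id_comp,
          Iso.inv_hom_id]
        exact Q.id_mem _ (Q.target_mem _ he)
      · exact absurd (leOfHom f) (ha j hjs).not_ge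
      · rw [hF's i his, hF'a]
        exact h2 i his
      · rw [hF's i his, hF's j hjs]
        exact h3 his hjs f

section

variable {K : Type} [Preorder K] (M : K ⥤ A) {k k' k'' : K} {x x' x'' : A}

/-- The morphism obtained from `M.obj k ⟶ M.obj k'` by replacing source and target by isomorphic
objects. -/
def conj (i : M.obj k ≅ x) (i' : M.obj k' ≅ x') (h : k ≤ k') : x ⟶ x' :=
  i.inv ≫ M.map (homOfLE h) ≫ i'.hom

variable {M} {i : M.obj k ≅ x} {i' : M.obj k' ≅ x'} {i'' : M.obj k'' ≅ x''}

theorem conj_comp_conj (h : k ≤ k') (h' : k' ≤ k'') :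
    conj M i i' h ≫ conj M i' i'' h' = conj M i i'' (h.trans h') := by
  simp only [conj, Category.assoc, Iso.hom_inv_id_assoc, ← Functor.map_comp_assoc, homOfLE_comp]

theorem conj_self (h : k ≤ k) : conj M i i h = 𝟙 x := by
  rw [conj, show homOfLE h = 𝟙 k from rfl, M.map_id, Category.id_comp, Iso.inv_hom_id]

variable {Q}

theorem conj_trans {h : k ≤ k'} (H : Q.hom (conj M i i' h)) {h' : k' ≤ k''}
    (H' : Q.hom (conj M i' i'' h')) (h'' : k ≤ k'') : Q.hom (conj M i i'' h'') := by
  have := Q.comp_mem _ _ H H'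
  rwa [conj_comp_conj] at this

/-- In a partial order `k = k'`, but `i` and `i'` may be different replacements of the same object,
as happens at the ends of a diagonal. -/
theorem conj_symm {h : k ≤ k'} (H : Q.hom (conj M i i' h)) (h' : k' ≤ k) :
    Q.hom (conj M i' i h') :=
  Q.inv_mem ⟨conj M i i' h, conj M i' i h', by rw [conj_comp_conj, conj_self],
    by rw [conj_comp_conj, conj_self]⟩ H

end

variable {Q}

/-- The objects at inner vertices lie between those at `a` and `b`, where `exists_chain_mem`
applies. A vertex common to both pieces is replaced twice; comparisons between inner and outer
replacements go through `a` or `b`. -/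
theorem exists_replacement {I J K : Type} [LinearOrder I] [Fintype I] [BoundedOrder I]
    [PartialOrder J] [BoundedOrder J] [PartialOrder K] {α : I →o K} {β : J →o K} {a b : J}
    (h : IsDecomposition α β a b) (M : K ⥤ A) (hM : ∀ {k k'} (f : k ⟶ k'), Epi (M.map f))
    {N : J → A} (ε : ∀ j, M.obj (β j) ≅ N j)
    (hε : ∀ {j j'} (hj : j ≤ j'), Q.hom (conj M (ε j) (ε j') (β.monotone hj))) :
    ∃ (Z : I → A) (ζ : ∀ l, M.obj (α l) ≅ Z l),
      (∀ {j j'} (hj : β j ≤ β j'), Q.hom (conj M (ε j) (ε j') hj)) ∧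
      (∀ {j l} (hj : β j ≤ α l), Q.hom (conj M (ε j) (ζ l) hj)) ∧
      (∀ {l j} (hl : α l ≤ β j), Q.hom (conj M (ζ l) (ε j) hl)) ∧
      ∀ {l l'} (hl : α l ≤ α l'), Q.hom (conj M (ζ l) (ζ l') hl) := by
  have hal : ∀ l, β a ≤ α l := fun l => h.left.le.trans (α.monotone bot_le)
  have hlb : ∀ l, α l ≤ β b := fun l => (α.monotone le_top).trans h.right.ge
  obtain ⟨F, h1, h2, h3⟩ := Q.exists_chain_mem (α.monotone.functor ⋙ M)
    (fun l => (ε a).inv ≫ M.map (homOfLE (hal l)))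
    (fun l => by
      have := hM (homOfLE (hal l))
      exact epi_comp _ _)
    (fun {l l'} f => by
      rw [Category.assoc]
      congr 1
      exact (M.map_comp _ _).symm)
    Finset.univ (fun l _ => M.map (homOfLE (hlb l)) ≫ (ε b).hom)
    (fun l _ => by
      have := hM (homOfLE (hlb l))
      exact epi_comp _ _)
    (fun {l l'} _ _ f => by
      rw [← Category.assoc]
      congr 1
      exact (M.map_comp _ _).symm)
    (fun l _ => by
      have := hε h.le
      rw [conj, show homOfLE (β.monotone h.le) = homOfLE (hal l) ≫ homOfLE (hlb l) from rfl,
        M.map_comp] at this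
      have e : Q.hom (((ε a).inv ≫ M.map (homOfLE (hal l))) ≫ M.map (homOfLE (hlb l)) ≫
          (ε b).hom) := by
        simpa only [Category.assoc] using this
      exact e)
  have c1 : ∀ l, Q.hom (conj M (ε a) (F l).2 (hal l)) := fun l => by
    have := h1 l (Finset.mem_univ l)
    rwa [Category.assoc] at this
  have c2 : ∀ l, Q.hom (conj M (F l).2 (ε b) (hlb l)) := fun l => h2 l (Finset.mem_univ l)
  have c3 : ∀ {l l'} (hl : l ≤ l'), Q.hom (conj M (F l).2 (F l').2 (α.monotone hl)) :=
    fun {l l'} hl => h3 (Finset.mem_univ l) (Finset.mem_univ l') (homOfLE hl)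
  refine ⟨fun l => (F l).1, fun l => (F l).2, fun {j j'} hj => ?_, fun {j l} hj => ?_,
    fun {l j} hl => ?_, fun hl => c3 (h.le_of_inner_le_inner hl)⟩
  · rcases h.le_of_outer_le_outer hj with hj' | ⟨hI, hjb, haj⟩
    · exact hε hj'
    -- In the degenerate case the path is `j ⟶ b ⟶ a ⟶ j'`, where `b ⟶ a` inverts a morphism of `Q`.
    · have hba : β b ≤ β a := h.right.le.trans ((α.monotone hI).trans h.left.ge)
      exact conj_trans (conj_trans (hε hjb) (conj_symm (hε h.le) hba) ((β.monotone hjb).trans hba))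
        (hε haj) _
  · rcases h.le_of_outer_le_inner hj with hja | ⟨hl, hjb⟩
    · exact conj_trans (hε hja) (c1 l) _
    · exact conj_trans (hε hjb) (conj_symm (c2 l) (h.right.le.trans (α.monotone hl))) _
  · rcases h.le_of_inner_le_outer hl with hbj | ⟨hl', haj⟩
    · exact conj_trans (c2 l) (hε hbj) _
    · exact conj_trans (conj_symm (c1 l) ((α.monotone hl').trans h.left.ge)) (hε haj) _

end QuotientDatum

/-- The chain of quotients `A_{+∞} / A_k` of a flag indexed by `K ∪ {+∞}`. -/
def WaldhausenFlag.tail {K : Type} [Preorder K] {A : Type u} [Category.{v} A]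
    (E : WaldhausenFlag (WithTop K) A) : K ⥤ A where
  obj k := E.obj (le_top : (k : WithTop K) ≤ ⊤)
  map f := E.map le_top le_top (WithTop.coe_le_coe.2 (leOfHom f)) le_rfl
  map_id _ := E.map_self _
  map_comp _ _ := (E.map_comp_map _ _ _ _ _ _ _).symm

namespace QuotientDatum

variable {A : Type u} [Category.{v} A] {Q : QuotientDatum A} {K : Type} [PartialOrder K]

/-- Transport of structure: only the objects `A_{+∞} / A_k` are changed. Several `c` may lie over
the same `k`; one is chosen, and `H` puts the passage to the others in `Q`. -/
theorem exists_boundedFlag (E : WaldhausenFlag (WithTop K) A) {P : Type} {π : P → K}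
    (hπ : ∀ k, ∃ c, π c = k) {Z : P → A}
    (ε : ∀ c, E.obj (le_top : (π c : WithTop K) ≤ ⊤) ≅ Z c)
    (H : ∀ {c c'} (h : π c ≤ π c'), Q.hom ((ε c).inv ≫
      E.map le_top le_top (WithTop.coe_le_coe.2 h) le_rfl ≫ (ε c').hom)) :
    ∃ (E' : Q.BoundedFlag K) (e : E'.flag.diagram ≅ E.diagram), ∀ c,
      Q.hom (e.hom.app (IntervalPoset.mk (le_top : (π c : WithTop K) ≤ ⊤)) ≫ (ε c).hom) := by
  have N : ∀ p : IntervalPoset (WithTop K), ∃ (Z' : A) (ι : E.diagram.obj p ≅ Z'),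
      ∀ c (h : p = IntervalPoset.mk (le_top : (π c : WithTop K) ≤ ⊤)),
        Q.hom (ι.inv ≫ E.diagram.map (homOfLE h.le) ≫ (ε c).hom) ∧
        Q.hom ((ε c).inv ≫ E.diagram.map (homOfLE h.ge) ≫ ι.hom) := fun p => by
    by_cases hp : ∃ c, p = IntervalPoset.mk (le_top : (π c : WithTop K) ≤ ⊤)
    · obtain ⟨c, rfl⟩ := hp
      refine ⟨Z c, ε c, fun c' h => ?_⟩
      have hc : π c = π c' := WithTop.coe_injective (congrArg (fun q => q.1.1) h)
      exact ⟨H hc.le, H hc.ge⟩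
    · exact ⟨_, Iso.refl _, fun c h => absurd ⟨c, h⟩ hp⟩
  choose Z' ι hι using N
  refine ⟨⟨E.ofIso (E.diagram.isoCopyObj Z' ι), fun {k k'} hk => ?_⟩,
    (E.diagram.isoCopyObj Z' ι).symm, fun c => ?_⟩
  · obtain ⟨c, rfl⟩ := hπ k
    obtain ⟨c', rfl⟩ := hπ k'
    have := Q.comp_mem _ _ (Q.comp_mem _ _ (hι _ c rfl).1 (H hk)) (hι _ c' rfl).2
    simp only [Category.assoc, Iso.hom_inv_id_assoc] at this
    rw [← Functor.map_comp_assoc, ← Functor.map_comp_assoc] at this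
    exact this
  · have := (hι _ c rfl).1
    rw [show homOfLE (le_refl (IntervalPoset.mk (le_top : (π c : WithTop K) ≤ ⊤))) = 𝟙 _ from rfl,
      E.diagram.map_id, Category.id_comp] at this
    exact this

end QuotientDatum

/-! ### Comparison functors -/

/-- In a groupoid, isomorphisms can be given as plain morphisms. The square commutes strictly, so
the gluing isomorphism of an object in the image is an `eqToHom`. -/
theorem TwoSegal.comparison_isEquivalence {W U V Z : Type*} [Groupoid W] [Groupoid U]
    [Groupoid V] [Groupoid Z] {t : W ⥤ U} {l : W ⥤ V} {r : U ⥤ Z} {b : V ⥤ Z}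
    (h : t ⋙ r = l ⋙ b)
    (faithful : ∀ {w w' : W} (f g : w ⟶ w'), t.map f = t.map g → l.map f = l.map g → f = g)
    (full : ∀ {w w' : W} (φ : t.obj w ⟶ t.obj w') (ψ : l.obj w ⟶ l.obj w'),
      r.map φ ≫ eqToHom (Functor.congr_obj h w') = eqToHom (Functor.congr_obj h w) ≫ b.map ψ →
        ∃ f : w ⟶ w', t.map f = φ ∧ l.map f = ψ)
    (essSurj : ∀ (x : U) (y : V) (θ : r.obj x ⟶ b.obj y),
      ∃ (w : W) (φ : t.obj w ⟶ x) (ψ : l.obj w ⟶ y),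
        r.map φ ≫ θ = eqToHom (Functor.congr_obj h w) ≫ b.map ψ) :
    (TwoSegal.comparison h).IsEquivalence where
  faithful := ⟨fun {w w'} f g e => faithful f g (congrArg (fun q => q.fst) e)
    (congrArg (fun q => q.snd) e)⟩
  full := ⟨fun {w w'} q => by
    obtain ⟨f, h1, h2⟩ := full q.fst q.snd q.w
    exact ⟨f, CategoricalPullback.hom_ext h1 h2⟩⟩
  essSurj := ⟨fun q => by
    obtain ⟨w, φ, ψ, e⟩ := essSurj q.fst q.snd q.iso.hom
    exact ⟨w, ⟨CategoricalPullback.mkIso ((Groupoid.isoEquivHom _ _).symm φ)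
      ((Groupoid.isoEquivHom _ _).symm ψ) e⟩⟩⟩

/-! ### Components of morphisms of flags under restriction -/

namespace WaldhausenFlag

variable {I J K L : Type} [Preorder I] [Preorder J] [Preorder K] [Preorder L]
variable {A : Type u} [Category.{v} A]

/-- The components of a morphism of flags. -/
def app {D E : WaldhausenFlag I A} (φ : D ⟶ E) {i j : I} (h : i ≤ j) : D.obj h ⟶ E.obj h :=
  (Iso.hom (X := D.diagram) (Y := E.diagram) φ).app (IntervalPoset.mk h)

/-- Restriction of morphisms of flags. -/
def restrictHom (f : I →o J) {D E : WaldhausenFlag J A} (φ : D ⟶ E) :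
    D.restrict f ⟶ E.restrict f :=
  (restrictFunctor f A).map φ

theorem comp_app {D E F : WaldhausenFlag I A} (φ : D ⟶ E) (ψ : E ⟶ F) {i j : I} (h : i ≤ j) :
    app (φ ≫ ψ) h = app φ h ≫ app ψ h :=
  rfl

theorem ext_of_app {D E : WaldhausenFlag I A} {o t : I} (ho : ∀ i, o ≤ i) (ht : ∀ i, i ≤ t)
    {φ ψ : D ⟶ E} (H : app φ (ho t) = app ψ (ho t)) : φ = ψ :=
  Iso.ext (hom_ext ho ht H)

theorem app_naturality {D E : WaldhausenFlag I A} (φ : D ⟶ E) {i j k l : I} (hij : i ≤ j)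
    (hkl : k ≤ l) (hik : i ≤ k) (hjl : j ≤ l) :
    D.map hij hkl hik hjl ≫ app φ hkl = app φ hij ≫ E.map hij hkl hik hjl :=
  naturality _ _ _ _ _

/-- Turns the `eqToHom` of a strictly commutative square into a structure map of the flag, so that
diagram calculations apply to it. -/
theorem eqToHom_restrict_app {f g : L →o K} (hfg : f = g) {D : WaldhausenFlag K A}
    (hD : D.restrict f = D.restrict g) {i j : L} (h : i ≤ j) (hf : f i ≤ f j) (hg : g i ≤ g j) :
    app (eqToHom hD) h = D.map hf hg (hfg ▸ le_rfl) (hfg ▸ le_rfl) := by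
  subst hfg
  rw [eqToHom_refl, map_self]
  rfl

end WaldhausenFlag

/-- The maps `ε` and `δ` include the diagonal into the two pieces of a decomposition. -/
structure IsDiagonal {I J K L : Type} [PartialOrder I] [BoundedOrder I] [PartialOrder J]
    [BoundedOrder J] [PartialOrder K] [PartialOrder L] [BoundedOrder L] (α : I →o K) (β : J →o K)
    (ε : L →o I) (δ : L →o J) : Prop where
  isDecomposition : IsDecomposition α β (δ ⊥) (δ ⊤)
  map_bot : ε ⊥ = ⊥
  map_top : ε ⊤ = ⊤
  comm : α.comp ε = β.comp δ

/-! ### Homotopy pullbacks of groupoids of flags -/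

namespace IsDiagonal

variable {I J K L : Type} [PartialOrder I] [BoundedOrder I] [PartialOrder J]
    [BoundedOrder J] [PartialOrder K] [PartialOrder L] [BoundedOrder L] {α : I →o K} {β : J →o K}
    {ε : L →o I} {δ : L →o J} {A : Type u} [Category.{v} A]

theorem inner_le (_ : IsDiagonal α β ε δ) : α (ε ⊥) ≤ α (ε ⊤) :=
  α.monotone (ε.monotone bot_le)

theorem outer_le (_ : IsDiagonal α β ε δ) : β (δ ⊥) ≤ β (δ ⊤) :=
  β.monotone (δ.monotone bot_le)

theorem left (h : IsDiagonal α β ε δ) : α (ε ⊥) = β (δ ⊥) :=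
  DFunLike.congr_fun h.comm ⊥

theorem right (h : IsDiagonal α β ε δ) : α (ε ⊤) = β (δ ⊤) :=
  DFunLike.congr_fun h.comm ⊤

/-- If `D` and `E` are flags on `K`, then two isomorphisms between their restrictions that agree
on the diagonal come from an isomorphism `D ≅ E`. -/
theorem exists_hom (h : IsDiagonal α β ε δ) {D E : WaldhausenFlag K A}
    (ψ : D.restrict α ⟶ E.restrict α) (φ : D.restrict β ⟶ E.restrict β)
    (hD : (D.restrict α).restrict ε = (D.restrict β).restrict δ)
    (hE : (E.restrict α).restrict ε = (E.restrict β).restrict δ)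
    (w : WaldhausenFlag.restrictHom ε ψ ≫ eqToHom hE =
      eqToHom hD ≫ WaldhausenFlag.restrictHom δ φ) :
    ∃ Φ : D ⟶ E, WaldhausenFlag.restrictHom α Φ = ψ ∧
      WaldhausenFlag.restrictHom β Φ = φ := by
  have hI : (⊥ : I) ≤ ⊤ := bot_le
  have hα : α ⊥ ≤ α ⊤ := h.isDecomposition.inner_le
  have hε : ε ⊥ ≤ ε ⊤ := ε.monotone bot_le
  have hL : (⊥ : L) ≤ ⊤ := bot_le
  have e1 : WaldhausenFlag.app (eqToHom hE) hL =
      E.map h.inner_le h.outer_le h.left.le h.right.le :=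
    WaldhausenFlag.eqToHom_restrict_app h.comm hE hL h.inner_le h.outer_le
  have e2 : WaldhausenFlag.app (eqToHom hD) hL =
      D.map h.inner_le h.outer_le h.left.le h.right.le :=
    WaldhausenFlag.eqToHom_restrict_app h.comm hD hL h.inner_le h.outer_le
  have w' : WaldhausenFlag.app _ hL = WaldhausenFlag.app _ hL :=
    congrArg (fun q => WaldhausenFlag.app q hL) w
  rw [WaldhausenFlag.comp_app, WaldhausenFlag.comp_app, e1, e2] at w'
  have w'' : WaldhausenFlag.restrictApp (f := α) (D := D) (E := E)
        (Iso.hom ψ) hε h.inner_le ≫ E.map h.inner_le h.outer_le h.left.le h.right.le =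
      D.map h.inner_le h.outer_le h.left.le h.right.le ≫
        WaldhausenFlag.restrictApp (f := β) (D := D) (E := E) (Iso.hom φ)
          h.isDecomposition.le h.outer_le := w'
  obtain ⟨Φ, h1, h2⟩ := h.isDecomposition.exists_iso (D := D) (E := E) φ ψ (by
    -- `ε ⊥ = ⊥` and `ε ⊤ = ⊤` hold only propositionally; naturality moves the component of `ψ` from
    -- one pair to the other.
    have n := WaldhausenFlag.restrictApp_naturality (f := α) (D := D) (E := E) (Iso.hom ψ)
      hε hI h.inner_le hα h.map_bot.le h.map_top.le (α.monotone h.map_bot.le)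
      (α.monotone h.map_top.le)
    have : IsIso (D.map h.inner_le h.outer_le h.left.le h.right.le) :=
      D.isIso_map _ _ _ _ h.left.ge h.right.ge
    rw [← cancel_epi (D.map h.inner_le h.outer_le h.left.le h.right.le), ← reassoc_of% w'',
      WaldhausenFlag.map_comp_map, WaldhausenFlag.map_comp_map_assoc, n])
  exact ⟨Φ, h2, h1⟩

/-- The outer piece contains the least and greatest vertices of `K`, hence the component that
determines a morphism. -/
theorem hom_ext (h : IsDiagonal α β ε δ) {D E : WaldhausenFlag K A} {Φ Ψ : D ⟶ E}
    (w : WaldhausenFlag.restrictHom β Φ =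
      WaldhausenFlag.restrictHom β Ψ) : Φ = Ψ :=
  WaldhausenFlag.ext_of_app h.isDecomposition.outer_bot_le h.isDecomposition.le_outer_top
    (congrArg (fun q => WaldhausenFlag.app q (bot_le : (⊥ : J) ≤ ⊤)) w)

theorem exists_glue [ProtoAbelian A] (h : IsDiagonal α β ε δ) (D' : WaldhausenFlag I A)
    (D : WaldhausenFlag J A) (θ : D'.restrict ε ⟶ D.restrict δ) :
    ∃ (E : WaldhausenFlag K A) (ψ : E.restrict α ⟶ D') (φ : E.restrict β ⟶ D),
      ∀ hE : (E.restrict α).restrict ε = (E.restrict β).restrict δ,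
        WaldhausenFlag.restrictHom ε ψ ≫ θ =
          eqToHom hE ≫ WaldhausenFlag.restrictHom δ φ := by
  have hI : (⊥ : I) ≤ ⊤ := bot_le
  have hα : α ⊥ ≤ α ⊤ := h.isDecomposition.inner_le
  have hε : ε ⊥ ≤ ε ⊤ := ε.monotone bot_le
  have hδ : δ ⊥ ≤ δ ⊤ := δ.monotone bot_le
  have hL : (⊥ : L) ≤ ⊤ := bot_le
  obtain ⟨θ', hθ⟩ : ∃ θ' : D'.obj hε ≅ D.obj hδ, θ'.hom = WaldhausenFlag.app θ hL :=
    ⟨Iso.app (F := (D'.restrict ε).diagram) (G := (D.restrict δ).diagram) θ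
      (IntervalPoset.mk hL), rfl⟩
  have : IsIso (D'.map hε hI h.map_bot.le h.map_top.le) :=
    D'.isIso_map _ _ _ _ h.map_bot.ge h.map_top.ge
  obtain ⟨E, φ, ψ, w⟩ := h.isDecomposition.exists_glue D D'
    (θ'.symm ≪≫ asIso (D'.map hε hI h.map_bot.le h.map_top.le))
  refine ⟨E, ψ, φ, fun hE => ?_⟩
  refine WaldhausenFlag.ext_of_app (fun _ => bot_le) (fun _ => le_top) ?_
  have e1 : WaldhausenFlag.app (eqToHom hE) hL =
      E.map h.inner_le h.outer_le h.left.le h.right.le :=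
    WaldhausenFlag.eqToHom_restrict_app h.comm hE hL h.inner_le h.outer_le
  rw [WaldhausenFlag.comp_app, WaldhausenFlag.comp_app, e1, ← hθ]
  have n : E.map h.inner_le hα (α.monotone h.map_bot.le) (α.monotone h.map_top.le) ≫
      WaldhausenFlag.ofRestrictApp ψ.hom hI hα = WaldhausenFlag.ofRestrictApp ψ.hom hε h.inner_le ≫
        D'.map hε hI h.map_bot.le h.map_top.le :=
    ψ.hom.naturality (IntervalPoset.homMk hε hI h.map_bot.le h.map_top.le)
  have key : WaldhausenFlag.ofRestrictApp ψ.hom hε h.inner_le ≫ θ'.hom =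
      E.map h.inner_le h.outer_le h.left.le h.right.le ≫
        WaldhausenFlag.ofRestrictApp φ.hom hδ h.outer_le := by
    rw [← cancel_mono (θ'.symm ≪≫ asIso (D'.map hε hI h.map_bot.le h.map_top.le)).hom,
      Category.assoc, Category.assoc, w, WaldhausenFlag.map_comp_map_assoc, n]
    simp
  exact key

theorem comparison_isEquivalence [ProtoAbelian A] (h : IsDiagonal α β ε δ)
    (hc : WaldhausenFlag.restrictFunctor α A ⋙ WaldhausenFlag.restrictFunctor ε A =
      WaldhausenFlag.restrictFunctor β A ⋙ WaldhausenFlag.restrictFunctor δ A) :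
    (TwoSegal.comparison hc).IsEquivalence := by
  refine TwoSegal.comparison_isEquivalence hc (fun f g _ hl => h.hom_ext hl) ?_ ?_
  · intro D E ψ φ w
    exact h.exists_hom ψ φ _ _ w
  · intro D' D θ
    obtain ⟨E, ψ, φ, w⟩ := h.exists_glue D' D θ
    exact ⟨E, ψ, φ, w _⟩

end IsDiagonal

namespace WaldhausenFlag

variable {K L : Type} [Preorder K] [Preorder L] {A : Type u} [Category.{v} A]

theorem restrictHom_comp_eqToHom {f g : L →o K} (hfg : f = g) {D E : WaldhausenFlag K A}
    (e : D ⟶ E) (hD : D.restrict f = D.restrict g) (hE : E.restrict f = E.restrict g) :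
    restrictHom f e ≫ eqToHom hE = eqToHom hD ≫ restrictHom g e := by
  subst hfg
  rw [eqToHom_refl, eqToHom_refl, Category.comp_id, Category.id_comp]

end WaldhausenFlag

namespace IsDiagonal

section

variable {I J K L : Type} [PartialOrder I] [BoundedOrder I] [PartialOrder J]
    [BoundedOrder J] [PartialOrder K] [PartialOrder L] [BoundedOrder L] {α : I →o K} {β : J →o K}
    {ε : L →o I} {δ : L →o J} {A : Type u} [Category.{v} A]

/-- Gluing takes place in `A`, without regard to `Q`; the glued flag is later replaced by an
isomorphic bounded one, and this keeps the compatibility. -/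
theorem square_precomp (h : IsDiagonal α β ε δ) {E E' : WaldhausenFlag K A}
    {D' : WaldhausenFlag I A} {D : WaldhausenFlag J A} {θ : D'.restrict ε ⟶ D.restrict δ}
    {ψ : E.restrict α ⟶ D'} {φ : E.restrict β ⟶ D}
    (w : ∀ hE : (E.restrict α).restrict ε = (E.restrict β).restrict δ,
      WaldhausenFlag.restrictHom ε ψ ≫ θ = eqToHom hE ≫ WaldhausenFlag.restrictHom δ φ)
    (e : E' ⟶ E) (hE' : (E'.restrict α).restrict ε = (E'.restrict β).restrict δ) :
    WaldhausenFlag.restrictHom ε (WaldhausenFlag.restrictHom α e ≫ ψ) ≫ θ =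
      eqToHom hE' ≫ WaldhausenFlag.restrictHom δ (WaldhausenFlag.restrictHom β e ≫ φ) := by
  have hE : (E.restrict α).restrict ε = (E.restrict β).restrict δ := by
    change E.restrict (α.comp ε) = E.restrict (β.comp δ)
    rw [h.comm]
  have e1 : WaldhausenFlag.restrictHom ε (WaldhausenFlag.restrictHom α e ≫ ψ) =
    WaldhausenFlag.restrictHom ε (WaldhausenFlag.restrictHom α e) ≫
      WaldhausenFlag.restrictHom ε ψ := rfl
  have e2 : WaldhausenFlag.restrictHom δ (WaldhausenFlag.restrictHom β e ≫ φ) =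
    WaldhausenFlag.restrictHom δ (WaldhausenFlag.restrictHom β e) ≫
      WaldhausenFlag.restrictHom δ φ := rfl
  have e3 : WaldhausenFlag.restrictHom ε (WaldhausenFlag.restrictHom α e) ≫ eqToHom hE =
      eqToHom hE' ≫ WaldhausenFlag.restrictHom δ (WaldhausenFlag.restrictHom β e) :=
    WaldhausenFlag.restrictHom_comp_eqToHom h.comm e hE' hE
  rw [e1, e2, Category.assoc, w hE, reassoc_of% e3]

end

/-- The inclusion of `I` into `I ∪ {+∞}`. -/
abbrev coeTop (I : Type) [Preorder I] : I →o WithTop I :=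
  ⟨fun i => (i : WithTop I), fun _ _ h => WithTop.coe_le_coe.mpr h⟩

/-- The new greatest vertex `+∞` goes to the outer piece; the inner polygon and the diagonal are
unchanged. -/
theorem extendTop {I J K L : Type} [PartialOrder I] [BoundedOrder I] [PartialOrder J]
    [BoundedOrder J] [PartialOrder K] [PartialOrder L] [BoundedOrder L] {α : I →o K} {β : J →o K}
    {ε : L →o I} {δ : L →o J} (h : IsDiagonal α β ε δ) :
    IsDiagonal ((coeTop K).comp α) (QuotientDatum.extendTop β) ε ((coeTop J).comp δ) where
  isDecomposition :=
    { le := WithTop.coe_le_coe.2 h.isDecomposition.le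
      outer_bot_le k := by
        cases k with
        | top => exact le_top
        | coe k => exact WithTop.coe_le_coe.2 (h.isDecomposition.outer_bot_le k)
      le_outer_top k := le_top
      left := congrArg WithTop.some h.isDecomposition.left
      right := congrArg WithTop.some h.isDecomposition.right
      cover k := by
        cases k with
        | top => exact Or.inl ⟨⊤, rfl⟩
        | coe k =>
          rcases h.isDecomposition.cover k with ⟨j, rfl⟩ | ⟨l, rfl⟩
          · exact Or.inl ⟨j, rfl⟩
          · exact Or.inr ⟨l, rfl⟩
      le_of_inner_le_inner hl := h.isDecomposition.le_of_inner_le_inner (WithTop.coe_le_coe.1 hl)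
      le_of_outer_le_outer {j j'} hj := by
        cases j' with
        | top => exact Or.inl le_top
        | coe j' =>
          cases j with
          | top => exact absurd (top_le_iff.1 hj) (WithTop.coe_ne_top (a := β j'))
          | coe j =>
            rcases h.isDecomposition.le_of_outer_le_outer (WithTop.coe_le_coe.1 hj) with
              hj | ⟨h1, h2, h3⟩
            · exact Or.inl (WithTop.coe_le_coe.2 hj)
            · exact Or.inr ⟨h1, WithTop.coe_le_coe.2 h2, WithTop.coe_le_coe.2 h3⟩
      le_of_outer_le_inner {j l} hj := by
        cases j with
        | top => exact absurd (top_le_iff.1 hj) (WithTop.coe_ne_top (a := α l))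
        | coe j =>
          rcases h.isDecomposition.le_of_outer_le_inner (WithTop.coe_le_coe.1 hj) with
            hj | ⟨h1, h2⟩
          · exact Or.inl (WithTop.coe_le_coe.2 hj)
          · exact Or.inr ⟨h1, WithTop.coe_le_coe.2 h2⟩
      le_of_inner_le_outer {l j} hl := by
        cases j with
        | top => exact Or.inl le_top
        | coe j =>
          rcases h.isDecomposition.le_of_inner_le_outer (WithTop.coe_le_coe.1 hl) with
            hj | ⟨h1, h2⟩
          · exact Or.inl (WithTop.coe_le_coe.2 hj)
          · exact Or.inr ⟨h1, WithTop.coe_le_coe.2 h2⟩ }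
  map_bot := h.map_bot
  map_top := h.map_top
  comm := by
    ext k
    exact congrArg WithTop.some (DFunLike.congr_fun h.comm k)

end IsDiagonal

/-! ### Homotopy pullbacks of groupoids of bounded flags -/

namespace QuotientDatum

variable {A : Type u} [Category.{v} A] {Q : QuotientDatum A}

theorem inclusion_injective {I : Type} [Preorder I] {D E : Q.BoundedFlag I} {f g : D ⟶ E}
    (h : (Q.inclusion I).map f = (Q.inclusion I).map g) : f = g :=
  BoundedFlag.Hom.ext h

theorem inclusion_map_eqToHom {I : Type} [Preorder I] {X Y : Q.BoundedFlag I} (h : X = Y) :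
    (Q.inclusion I).map (eqToHom h) = eqToHom (congrArg BoundedFlag.flag h) := by
  subst h
  rfl

theorem exists_hom_of_mem {I : Type} [Preorder I] {D E : Q.BoundedFlag I} (Φ : D.flag ⟶ E.flag)
    (H : ∀ i : I, Q.hom (WaldhausenFlag.app Φ (le_top : (i : WithTop I) ≤ ⊤))) :
    ∃ Ψ : D ⟶ E, (Q.inclusion I).map Ψ = Φ :=
  ⟨⟨Φ, H, fun i => Q.inv_mem (Iso.app (F := D.flag.diagram) (G := E.flag.diagram) Φ _) (H i)⟩, rfl⟩

section Finite

variable {I J K L : Type} [LinearOrder I] [BoundedOrder I] [PartialOrder J]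
    [BoundedOrder J] [PartialOrder K] [PartialOrder L] [BoundedOrder L] {α : I →o K} {β : J →o K}
    {ε : L →o I} {δ : L →o J}

/-- At an inner vertex the component of `Φ` relates the middle objects of two factorizations in `Q`
of the same epimorphism `A_{+∞} / A_a ↠ A_{+∞} / A_b`, so the isomorphism axiom applies. -/
theorem mem_of_outer_mem (h : IsDiagonal α β ε δ) {D E : Q.BoundedFlag K} (Φ : D.flag ⟶ E.flag)
    (H : ∀ j : J, Q.hom (WaldhausenFlag.app Φ (le_top : (β j : WithTop K) ≤ ⊤))) (k : K) :
    Q.hom (WaldhausenFlag.app Φ (le_top : (k : WithTop K) ≤ ⊤)) := by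
  rcases h.isDecomposition.cover k with ⟨j, rfl⟩ | ⟨l, rfl⟩
  · exact H j
  · have hal : β (δ ⊥) ≤ α l := h.isDecomposition.left.le.trans (α.monotone bot_le)
    have hlb : α l ≤ β (δ ⊤) := (α.monotone le_top).trans h.isDecomposition.right.ge
    have n1 := WaldhausenFlag.app_naturality Φ (le_top : (β (δ ⊥) : WithTop K) ≤ ⊤)
      (le_top : (α l : WithTop K) ≤ ⊤) (WithTop.coe_le_coe.2 hal) le_rfl
    have n2 := WaldhausenFlag.app_naturality Φ (le_top : (α l : WithTop K) ≤ ⊤)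
      (le_top : (β (δ ⊤) : WithTop K) ≤ ⊤) (WithTop.coe_le_coe.2 hlb) le_rfl
    let e : D.flag.obj (le_top : (α l : WithTop K) ≤ ⊤) ≅ E.flag.obj le_top :=
      Iso.app (F := D.flag.diagram) (G := E.flag.diagram) Φ _
    let e' : D.flag.obj (le_top : (β (δ ⊤) : WithTop K) ≤ ⊤) ≅ E.flag.obj le_top :=
      Iso.app (F := D.flag.diagram) (G := E.flag.diagram) Φ _
    have he : e.hom = WaldhausenFlag.app Φ le_top := rfl
    have he' : e'.hom = WaldhausenFlag.app Φ le_top := rfl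
    rw [← he] at n1 n2
    rw [← he'] at n2
    -- The second factorization is that of `E`, with its ends moved to `D` along the components of
    -- `Φ` at `δ ⊥` and `δ ⊤`.
    refine Q.iso_mem
      (D.flag.map (le_top : (β (δ ⊥) : WithTop K) ≤ ⊤) le_top (WithTop.coe_le_coe.2 hal) le_rfl)
      (D.flag.map le_top (le_top : (β (δ ⊤) : WithTop K) ≤ ⊤) (WithTop.coe_le_coe.2 hlb) le_rfl)
      e (D.flag.epi_map _ _ _) (D.flag.epi_map _ _ _) (D.mem hal) (D.mem hlb) ?_ ?_
    · rw [n1]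
      exact Q.comp_mem _ _ (H (δ ⊥)) (E.mem hal)
    · have : e.inv ≫ D.flag.map le_top (le_top : (β (δ ⊤) : WithTop K) ≤ ⊤)
          (WithTop.coe_le_coe.2 hlb) le_rfl = E.flag.map le_top (le_top : (β (δ ⊤) : WithTop K) ≤ ⊤)
            (WithTop.coe_le_coe.2 hlb) le_rfl ≫ e'.inv := by
        rw [Iso.inv_comp_eq, ← reassoc_of% n2, Iso.hom_inv_id, Category.comp_id]
      rw [this]
      exact Q.comp_mem _ _ (E.mem hlb) (Q.inv_mem e' (H (δ ⊤)))

/-- The quotients at outer vertices are replaced by those of `D` and the inner ones by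
`exists_replacement`; this brings the components of `φ` into `Q`. -/
theorem exists_boundedFlag_of_outer [Fintype I] [ProtoAbelian A] (h : IsDiagonal α β ε δ)
    (E : WaldhausenFlag (WithTop K) A) (D : Q.BoundedFlag J)
    (φ : E.restrict (extendTop β) ⟶ D.flag) :
    ∃ (E' : Q.BoundedFlag K) (e : E'.flag ⟶ E) (Φ : (Q.restrictFunctor β).obj E' ⟶ D),
      (Q.inclusion J).map Φ = WaldhausenFlag.restrictHom (extendTop β) e ≫ φ := by
  let η : ∀ j : J, E.obj (le_top : (β j : WithTop K) ≤ ⊤) ≅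
      D.flag.obj (le_top : (j : WithTop J) ≤ ⊤) := fun j =>
    Iso.app (F := (E.restrict (extendTop β)).diagram) (G := D.flag.diagram) φ
      (IntervalPoset.mk (le_top : (j : WithTop J) ≤ ⊤))
  have nη : ∀ {j j' : J} (hj : j ≤ j'),
      E.map le_top le_top (WithTop.coe_le_coe.2 (β.monotone hj)) le_rfl ≫ (η j').hom =
        (η j).hom ≫ D.flag.map le_top le_top (WithTop.coe_le_coe.2 hj) le_rfl := fun hj =>
    WaldhausenFlag.app_naturality (D := E.restrict (extendTop β)) (E := D.flag) φ
      le_top le_top (WithTop.coe_le_coe.2 hj) le_rfl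
  have Hη : ∀ {j j' : J} (hj : j ≤ j'), Q.hom ((η j).inv ≫
      E.map le_top le_top (WithTop.coe_le_coe.2 (β.monotone hj)) le_rfl ≫ (η j').hom) :=
    fun hj => by
      rw [nη hj, Iso.inv_hom_id_assoc]
      exact D.mem hj
  obtain ⟨Z, ζ, h1, h2, h3, h4⟩ := exists_replacement (Q := Q) h.isDecomposition E.tail
    (fun f => E.epi_map _ _ _) (N := fun j => D.flag.obj (le_top : (j : WithTop J) ≤ ⊤)) η Hη
  obtain ⟨E', e, he⟩ := exists_boundedFlag (Q := Q) E (P := J ⊕ I) (π := Sum.elim β α)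
    (fun k => (h.isDecomposition.cover k).elim (fun ⟨j, hj⟩ => ⟨Sum.inl j, hj⟩)
      (fun ⟨l, hl⟩ => ⟨Sum.inr l, hl⟩))
    (Z := Sum.elim (fun j => D.flag.obj (le_top : (j : WithTop J) ≤ ⊤)) Z)
    (fun c => match c with
      | Sum.inl j => η j
      | Sum.inr l => ζ l)
    (fun {c c'} => match c, c' with
      | Sum.inl _, Sum.inl _ => h1
      | Sum.inl _, Sum.inr _ => h2
      | Sum.inr _, Sum.inl _ => h3
      | Sum.inr _, Sum.inr _ => h4)
  obtain ⟨Φ, hΦ⟩ := exists_hom_of_mem (D := (Q.restrictFunctor β).obj E') (E := D)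
    (WaldhausenFlag.restrictHom (extendTop β) (D := E'.flag) (E := E) e ≫ φ)
    (fun j => he (Sum.inl j))
  exact ⟨E', e, Φ, hΦ⟩

theorem comparison_isEquivalence_of_finite [Fintype I] [ProtoAbelian A] (h : IsDiagonal α β ε δ)
    (hc : (Q.restrictFunctor α ⋙ Q.forgetTop I) ⋙ WaldhausenFlag.restrictFunctor ε A =
      Q.restrictFunctor β ⋙ Q.restrictFunctor δ ⋙ Q.forgetTop L) :
    (TwoSegal.comparison hc).IsEquivalence := by
  refine TwoSegal.comparison_isEquivalence hc ?_ ?_ ?_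
  · intro D E f g _ hl
    exact inclusion_injective (h.extendTop.hom_ext (congrArg (Q.inclusion J).map hl))
  · intro D E ψ φ w
    obtain ⟨Φ, h1, h2⟩ := h.extendTop.exists_hom (D := D.flag) (E := E.flag) ψ
      ((Q.inclusion J).map φ) (Functor.congr_obj hc D) (Functor.congr_obj hc E) w
    obtain ⟨Ψ, hΨ⟩ := exists_hom_of_mem Φ (mem_of_outer_mem h Φ fun j => by
      have : WaldhausenFlag.app (WaldhausenFlag.restrictHom (extendTop β) Φ)
          (le_top : (j : WithTop J) ≤ ⊤) = WaldhausenFlag.app ((Q.inclusion J).map φ) le_top :=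
        congrArg (fun q => WaldhausenFlag.app q (le_top : (j : WithTop J) ≤ ⊤)) h2
      have H : Q.hom (WaldhausenFlag.app ((Q.inclusion J).map φ)
        (le_top : (j : WithTop J) ≤ ⊤)) := φ.hom_mem j
      rw [← this] at H
      exact H)
    subst hΨ
    exact ⟨Ψ, h1, inclusion_injective h2⟩
  · intro D' D θ
    obtain ⟨E, ψ, φ, w⟩ := h.extendTop.exists_glue D' D.flag θ
    obtain ⟨E', e, Φ, hΦ⟩ := exists_boundedFlag_of_outer h E D φ
    have := h.extendTop.square_precomp w e (Functor.congr_obj hc E')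
    rw [← hΦ] at this
    exact ⟨E', WaldhausenFlag.restrictHom ((IsDiagonal.coeTop K).comp α) e ≫ ψ, Φ, this⟩

end Finite

section Infinite

variable {I J K L : Type} [PartialOrder I] [OrderBot I] [PartialOrder J] [OrderBot J]
    [PartialOrder K] [PartialOrder L] [OrderBot L] {α : I →o K} {β : J →o K} {ε : L →o I}
    {δ : L →o J}

/-- Each finite vertex lies in a piece that prescribes its quotient in `Q`. At the common vertex
there are two prescriptions, which differ by a component of `θ` lying in `Q`. -/
theorem exists_boundedFlag_of_inner_of_outer (h : IsDiagonal (extendTop α) (extendTop β)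
      (extendTop ε) (extendTop δ)) (E : WaldhausenFlag (WithTop K) A) (D' : Q.BoundedFlag I)
    (D : Q.BoundedFlag J) (θ : D'.flag.restrict (extendTop ε) ⟶ D.flag.restrict (extendTop δ))
    (mθ : Q.hom (WaldhausenFlag.app θ (le_top : ((⊥ : L) : WithTop L) ≤ ⊤)))
    (ψ : E.restrict (extendTop α) ⟶ D'.flag) (φ : E.restrict (extendTop β) ⟶ D.flag)
    (w : ∀ hE : (E.restrict (extendTop α)).restrict (extendTop ε) =
        (E.restrict (extendTop β)).restrict (extendTop δ),
      WaldhausenFlag.restrictHom (extendTop ε) ψ ≫ θ =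
        eqToHom hE ≫ WaldhausenFlag.restrictHom (extendTop δ) φ) :
    ∃ (E' : Q.BoundedFlag K) (e : E'.flag ⟶ E) (Ψ : (Q.restrictFunctor α).obj E' ⟶ D')
      (Φ : (Q.restrictFunctor β).obj E' ⟶ D),
      (Q.inclusion I).map Ψ = WaldhausenFlag.restrictHom (extendTop α) e ≫ ψ ∧
      (Q.inclusion J).map Φ = WaldhausenFlag.restrictHom (extendTop β) e ≫ φ := by
  let ζ : ∀ l : I, E.obj (le_top : (α l : WithTop K) ≤ ⊤) ≅
      D'.flag.obj (le_top : (l : WithTop I) ≤ ⊤) := fun l =>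
    Iso.app (F := (E.restrict (extendTop α)).diagram) (G := D'.flag.diagram) ψ
      (IntervalPoset.mk (le_top : (l : WithTop I) ≤ ⊤))
  let η : ∀ j : J, E.obj (le_top : (β j : WithTop K) ≤ ⊤) ≅
      D.flag.obj (le_top : (j : WithTop J) ≤ ⊤) := fun j =>
    Iso.app (F := (E.restrict (extendTop β)).diagram) (G := D.flag.diagram) φ
      (IntervalPoset.mk (le_top : (j : WithTop J) ≤ ⊤))
  have nζ : ∀ {l l' : I} (hl : l ≤ l'),
      E.map le_top le_top (WithTop.coe_le_coe.2 (α.monotone hl)) le_rfl ≫ (ζ l').hom =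
        (ζ l).hom ≫ D'.flag.map le_top le_top (WithTop.coe_le_coe.2 hl) le_rfl := fun hl =>
    WaldhausenFlag.app_naturality (D := E.restrict (extendTop α)) (E := D'.flag) ψ
      le_top le_top (WithTop.coe_le_coe.2 hl) le_rfl
  have nη : ∀ {j j' : J} (hj : j ≤ j'),
      E.map le_top le_top (WithTop.coe_le_coe.2 (β.monotone hj)) le_rfl ≫ (η j').hom =
        (η j).hom ≫ D.flag.map le_top le_top (WithTop.coe_le_coe.2 hj) le_rfl := fun hj =>
    WaldhausenFlag.app_naturality (D := E.restrict (extendTop β)) (E := D.flag) φ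
      le_top le_top (WithTop.coe_le_coe.2 hj) le_rfl
  have Hζ : ∀ {l l' : I} (hl : l ≤ l'),
      Q.hom (conj E.tail (ζ l) (ζ l') (α.monotone hl)) := fun {l l'} hl => by
    have : Q.hom ((ζ l).inv ≫
        E.map le_top le_top (WithTop.coe_le_coe.2 (α.monotone hl)) le_rfl ≫ (ζ l').hom) := by
      rw [nζ hl, Iso.inv_hom_id_assoc]
      exact D'.mem hl
    exact this
  have Hη : ∀ {j j' : J} (hj : j ≤ j'),
      Q.hom (conj E.tail (η j) (η j') (β.monotone hj)) := fun {j j'} hj => by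
    have : Q.hom ((η j).inv ≫
        E.map le_top le_top (WithTop.coe_le_coe.2 (β.monotone hj)) le_rfl ≫ (η j').hom) := by
      rw [nη hj, Iso.inv_hom_id_assoc]
      exact D.mem hj
    exact this
  have hl0 : (α (ε ⊥) : WithTop K) = β (δ ⊥) :=
    DFunLike.congr_fun h.comm ((⊥ : L) : WithTop L)
  have hl : α (ε ⊥) ≤ β (δ ⊥) := (WithTop.coe_injective hl0).le
  have hr : β (δ ⊥) ≤ α (ε ⊥) := (WithTop.coe_injective hl0).ge
  have hε : ε ⊥ = ⊥ := WithTop.coe_injective h.map_bot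
  have Hθ : Q.hom (conj E.tail (ζ (ε ⊥)) (η (δ ⊥)) hl) := by
    have hE : (E.restrict (extendTop α)).restrict (extendTop ε) =
        (E.restrict (extendTop β)).restrict (extendTop δ) := by
      change E.restrict ((extendTop α).comp (extendTop ε)) =
        E.restrict ((extendTop β).comp (extendTop δ))
      rw [h.comm]
    have hL : ((⊥ : L) : WithTop L) ≤ ⊤ := le_top
    have e1 : WaldhausenFlag.app (eqToHom hE) hL =
        E.map (le_top : (α (ε ⊥) : WithTop K) ≤ ⊤) (le_top : (β (δ ⊥) : WithTop K) ≤ ⊤)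
          (WithTop.coe_le_coe.2 hl) le_rfl :=
      WaldhausenFlag.eqToHom_restrict_app h.comm hE hL le_top le_top
    have w' : WaldhausenFlag.app _ hL = WaldhausenFlag.app _ hL :=
      congrArg (fun q => WaldhausenFlag.app q hL) (w hE)
    rw [WaldhausenFlag.comp_app, WaldhausenFlag.comp_app, e1] at w'
    obtain ⟨θ', mθ', w''⟩ : ∃ θ' : D'.flag.obj (le_top : (ε ⊥ : WithTop I) ≤ ⊤) ⟶
        D.flag.obj (le_top : (δ ⊥ : WithTop J) ≤ ⊤), Q.hom θ' ∧
        (ζ (ε ⊥)).hom ≫ θ' =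
          E.map (le_top : (α (ε ⊥) : WithTop K) ≤ ⊤) (le_top : (β (δ ⊥) : WithTop K) ≤ ⊤)
            (WithTop.coe_le_coe.2 hl) le_rfl ≫ (η (δ ⊥)).hom :=
      ⟨WaldhausenFlag.app θ hL, mθ, w'⟩
    have : Q.hom ((ζ (ε ⊥)).inv ≫
        E.map (le_top : (α (ε ⊥) : WithTop K) ≤ ⊤) (le_top : (β (δ ⊥) : WithTop K) ≤ ⊤)
          (WithTop.coe_le_coe.2 hl) le_rfl ≫ (η (δ ⊥)).hom) := by
      rw [← w'', Iso.inv_hom_id_assoc]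
      exact mθ'
    exact this
  obtain ⟨E', e, he⟩ := exists_boundedFlag (Q := Q) E (P := J ⊕ I) (π := Sum.elim β α)
    (fun k => by
      rcases h.isDecomposition.cover k with ⟨j, hj⟩ | ⟨l, hl⟩
      · cases j with
        | top => exact absurd hj.symm (WithTop.coe_ne_top (a := k))
        | coe j => exact ⟨Sum.inl j, WithTop.coe_injective hj⟩
      · cases l with
        | top => exact absurd hl.symm (WithTop.coe_ne_top (a := k))
        | coe l => exact ⟨Sum.inr l, WithTop.coe_injective hl⟩)
    (Z := Sum.elim (fun j => D.flag.obj (le_top : (j : WithTop J) ≤ ⊤))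
      (fun l => D'.flag.obj (le_top : (l : WithTop I) ≤ ⊤)))
    (fun c => match c with
      | Sum.inl j => η j
      | Sum.inr l => ζ l)
    (fun {c c'} => match c, c' with
      | Sum.inl j, Sum.inl j' => fun hc => by
        rcases h.isDecomposition.le_of_outer_le_outer
          (j := (j : WithTop J)) (j' := (j' : WithTop J)) (WithTop.coe_le_coe.2 hc) with hj | ⟨hI, -⟩
        · exact Hη (WithTop.coe_le_coe.1 hj)
        -- The inner polygon contains `+∞` besides a finite vertex, so it is never degenerate.
        · exact absurd (top_le_iff.1 hI) (WithTop.coe_ne_top (a := (⊥ : I)))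
      | Sum.inl j, Sum.inr l => fun hc => by
        rcases h.isDecomposition.le_of_outer_le_inner
          (j := (j : WithTop J)) (l := (l : WithTop I)) (WithTop.coe_le_coe.2 hc) with hj | ⟨hl', -⟩
        -- An outer vertex below a finite inner one is below the common vertex, and the comparison
        -- passes through it.
        · have hj' : j ≤ δ ⊥ := WithTop.coe_le_coe.1 hj
          have hl' : ε ⊥ ≤ l := hε.le.trans bot_le
          exact conj_trans (conj_trans (Hη hj') (conj_symm Hθ hr) ((β.monotone hj').trans hr))
            (Hζ hl') hc
        · exact absurd (top_le_iff.1 hl') (WithTop.coe_ne_top (a := l))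
      | Sum.inr l, Sum.inl j => fun hc => by
        rcases h.isDecomposition.le_of_inner_le_outer
          (j := (j : WithTop J)) (l := (l : WithTop I)) (WithTop.coe_le_coe.2 hc) with hj | ⟨hl', hj⟩
        · exact absurd (top_le_iff.1 hj) (WithTop.coe_ne_top (a := j))
        · have hj' : δ ⊥ ≤ j := WithTop.coe_le_coe.1 hj
          have hl'' : l ≤ ε ⊥ := (WithTop.coe_le_coe.1 hl').trans hε.ge
          exact conj_trans (conj_trans (Hζ hl'') Hθ ((α.monotone hl'').trans hl)) (Hη hj') hc
      | Sum.inr l, Sum.inr l' => fun hc =>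
        Hζ (WithTop.coe_le_coe.1 (h.isDecomposition.le_of_inner_le_inner
          (l := (l : WithTop I)) (l' := (l' : WithTop I)) (WithTop.coe_le_coe.2 hc))))
  obtain ⟨Φ, hΦ⟩ := exists_hom_of_mem (D := (Q.restrictFunctor β).obj E') (E := D)
    (WaldhausenFlag.restrictHom (extendTop β) (D := E'.flag) (E := E) e ≫ φ)
    (fun j => he (Sum.inl j))
  obtain ⟨Ψ, hΨ⟩ := exists_hom_of_mem (D := (Q.restrictFunctor α).obj E') (E := D')
    (WaldhausenFlag.restrictHom (extendTop α) (D := E'.flag) (E := E) e ≫ ψ)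
    (fun l => he (Sum.inr l))
  exact ⟨E', e, Ψ, Φ, hΨ, hΦ⟩

theorem comparison_isEquivalence_of_infinite [ProtoAbelian A]
    (h : IsDiagonal (extendTop α) (extendTop β) (extendTop ε) (extendTop δ))
    (hc : Q.restrictFunctor β ⋙ Q.restrictFunctor δ = Q.restrictFunctor α ⋙ Q.restrictFunctor ε) :
    (TwoSegal.comparison hc).IsEquivalence := by
  refine TwoSegal.comparison_isEquivalence hc ?_ ?_ ?_
  · intro D E f g hl _
    exact inclusion_injective (h.hom_ext (congrArg (Q.inclusion J).map hl))
  · intro D E φ ψ w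
    have hD := congrArg BoundedFlag.flag (Functor.congr_obj hc D)
    have hE := congrArg BoundedFlag.flag (Functor.congr_obj hc E)
    -- The square lists the outer piece first, whereas `IsDiagonal` lists the inner one first; hence
    -- this transposition, and the inverse of `θ` below.
    have w' : (Q.restrictFunctor ε).map ψ ≫ eqToHom (Functor.congr_obj hc E).symm =
        eqToHom (Functor.congr_obj hc D).symm ≫ (Q.restrictFunctor δ).map φ := by
      rw [← cancel_epi (eqToHom (Functor.congr_obj hc D)), ← reassoc_of% w]
      simp
    have w'' := congrArg (Q.inclusion L).map w'
    rw [Functor.map_comp, Functor.map_comp, inclusion_map_eqToHom, inclusion_map_eqToHom] at w''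
    obtain ⟨Φ, h1, h2⟩ := h.exists_hom (D := D.flag) (E := E.flag) ((Q.inclusion I).map ψ)
      ((Q.inclusion J).map φ) hD.symm hE.symm w''
    obtain ⟨Ψ, hΨ⟩ := exists_hom_of_mem Φ (fun k => by
      rcases h.isDecomposition.cover k with ⟨j, hj⟩ | ⟨l, hl⟩
      · cases j with
        | top => exact absurd hj.symm (WithTop.coe_ne_top (a := k))
        | coe j =>
          obtain rfl : β j = k := WithTop.coe_injective hj
          have : WaldhausenFlag.app (WaldhausenFlag.restrictHom (extendTop β) Φ)
              (le_top : (j : WithTop J) ≤ ⊤) = WaldhausenFlag.app ((Q.inclusion J).map φ) le_top :=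
            congrArg (fun q => WaldhausenFlag.app q (le_top : (j : WithTop J) ≤ ⊤)) h2
          have H : Q.hom (WaldhausenFlag.app ((Q.inclusion J).map φ)
            (le_top : (j : WithTop J) ≤ ⊤)) := φ.hom_mem j
          rw [← this] at H
          exact H
      · cases l with
        | top => exact absurd hl.symm (WithTop.coe_ne_top (a := k))
        | coe l =>
          obtain rfl : α l = k := WithTop.coe_injective hl
          have : WaldhausenFlag.app (WaldhausenFlag.restrictHom (extendTop α) Φ)
              (le_top : (l : WithTop I) ≤ ⊤) = WaldhausenFlag.app ((Q.inclusion I).map ψ) le_top :=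
            congrArg (fun q => WaldhausenFlag.app q (le_top : (l : WithTop I) ≤ ⊤)) h1
          have H : Q.hom (WaldhausenFlag.app ((Q.inclusion I).map ψ)
            (le_top : (l : WithTop I) ≤ ⊤)) := ψ.hom_mem l
          rw [← this] at H
          exact H)
    subst hΨ
    exact ⟨Ψ, inclusion_injective h2, inclusion_injective h1⟩
  · intro D D' θ
    obtain ⟨E, ψ, φ, w⟩ := h.exists_glue D'.flag D.flag ((Q.inclusion L).map (Groupoid.inv θ))
    obtain ⟨E', e, Ψ, Φ, hΨ, hΦ⟩ :=
      exists_boundedFlag_of_inner_of_outer h E D' D _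
        (BoundedFlag.Hom.hom_mem (Groupoid.inv θ) ⊥) ψ φ w
    have hE' := congrArg BoundedFlag.flag (Functor.congr_obj hc E')
    have := h.square_precomp w e hE'.symm
    rw [← hΦ, ← hΨ] at this
    have key : (Q.restrictFunctor ε).map Ψ ≫ Groupoid.inv θ =
        eqToHom (Functor.congr_obj hc E').symm ≫ (Q.restrictFunctor δ).map Φ := by
      apply inclusion_injective
      rw [Functor.map_comp, Functor.map_comp, inclusion_map_eqToHom]
      exact this
    refine ⟨E', Φ, Ψ, ?_⟩
    rw [← cancel_epi (eqToHom (Functor.congr_obj hc E').symm), ← reassoc_of% key,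
      Groupoid.inv_comp, Category.comp_id]
    simp

end Infinite

end QuotientDatum

/-! ### Combinatorics of the polygons -/

namespace TwoSegal

open Simplicial SimplexCategory

theorem innerPolygon_val {i m r : ℕ} (k : Fin (⦋m⦌.len + 1)) :
    ((innerPolygon i m r).toOrderHom k : ℕ) = i + k :=
  rfl

theorem outerPolygon_val {i m r : ℕ} (k : Fin (⦋i + 1 + r⦌.len + 1)) :
    ((outerPolygon i m r).toOrderHom k : ℕ) = if (k : ℕ) ≤ i then (k : ℕ) else k + m - 1 :=
  rfl

theorem endpoints_val {m : ℕ} (k : Fin (⦋1⦌.len + 1)) :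
    ((endpoints m).toOrderHom k : ℕ) = k * m :=
  rfl

theorem initialSegment_val {i r : ℕ} (k : Fin (⦋i⦌.len + 1)) :
    ((initialSegment i r).toOrderHom k : ℕ) = k :=
  rfl

theorem finalSegment_val {i r : ℕ} (k : Fin (⦋r⦌.len + 1)) :
    ((finalSegment i r).toOrderHom k : ℕ) = i + k :=
  rfl

theorem bot_val (n : ℕ) : ((⊥ : Fin (⦋n⦌.len + 1)) : ℕ) = 0 :=
  rfl

theorem top_val (n : ℕ) : ((⊤ : Fin (⦋n⦌.len + 1)) : ℕ) = n :=
  rfl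

theorem val_le {n : ℕ} (k : Fin (⦋n⦌.len + 1)) : (k : ℕ) ≤ n :=
  Nat.lt_succ_iff.1 k.2

/-- For `m = 0`, the inner polygon is a point and the outer map identifies `i` and `i + 1`; the
degenerate alternatives in `IsDecomposition` cover this, so unitality needs no separate proof. -/
theorem isDiagonal_polygon (i m r : ℕ) :
    IsDiagonal (innerPolygon i m r).toOrderHom (outerPolygon i m r).toOrderHom
      (endpoints m).toOrderHom (innerPolygon i 1 r).toOrderHom where
  isDecomposition :=
    { le := OrderHom.monotone _ bot_le
      outer_bot_le k := by
        rw [Fin.le_def, outerPolygon_val, bot_val]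
        simp
      le_outer_top k := by
        have := val_le k
        rw [Fin.le_def, outerPolygon_val, top_val]
        split_ifs <;> omega
      left := by
        apply Fin.ext
        rw [outerPolygon_val, innerPolygon_val, innerPolygon_val, bot_val, bot_val]
        simp
      right := by
        apply Fin.ext
        rw [outerPolygon_val, innerPolygon_val, innerPolygon_val, top_val, top_val]
        split_ifs <;> omega
      cover k := by
        have hk := val_le k
        rcases le_or_gt (k : ℕ) i with h | h
        · refine Or.inl ⟨⟨k, by simp only [SimplexCategory.len_mk]; omega⟩, Fin.ext ?_⟩
          rw [outerPolygon_val]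
          simp [h]
        · rcases le_or_gt (k : ℕ) (i + m) with h' | h'
          · refine Or.inr ⟨⟨k - i, by simp only [SimplexCategory.len_mk]; omega⟩, Fin.ext ?_⟩
            rw [innerPolygon_val]
            simp only
            omega
          -- Beyond `i` the outer map is `k ↦ k + m - 1`, with inverse `k ↦ k + 1 - m`.
          · refine Or.inl ⟨⟨k + 1 - m, by simp only [SimplexCategory.len_mk]; omega⟩, Fin.ext ?_⟩
            rw [outerPolygon_val]
            simp only
            split_ifs <;> omega
      le_of_inner_le_inner {l l'} h := by
        rw [Fin.le_def, innerPolygon_val, innerPolygon_val] at h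
        rw [Fin.le_def]
        omega
      le_of_outer_le_outer {j j'} h := by
        rw [Fin.le_def, outerPolygon_val, outerPolygon_val] at h
        simp only [Fin.le_def, innerPolygon_val, bot_val, top_val]
        split_ifs at h <;> omega
      le_of_outer_le_inner {j l} h := by
        have := val_le l
        rw [Fin.le_def, outerPolygon_val, innerPolygon_val] at h
        simp only [Fin.le_def, innerPolygon_val, bot_val, top_val]
        split_ifs at h <;> omega
      le_of_inner_le_outer {l j} h := by
        rw [Fin.le_def, outerPolygon_val, innerPolygon_val] at h
        simp only [Fin.le_def, innerPolygon_val, bot_val, top_val]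
        split_ifs at h <;> omega }
  map_bot := by
    apply Fin.ext
    rw [endpoints_val, bot_val, bot_val, zero_mul]
  map_top := by
    apply Fin.ext
    rw [endpoints_val, top_val, top_val, one_mul]
  comm := by
    ext k
    change i + (k : ℕ) * m = if i + (k : ℕ) ≤ i then i + (k : ℕ) else i + (k : ℕ) + m - 1
    have hk := val_le k
    obtain h | h : (k : ℕ) = 0 ∨ (k : ℕ) = 1 := by omega
    · simp [h]
    · simp only [h]
      split_ifs <;> omega

/-- The diagonal `{i, +∞}` is a single vertex with `+∞` adjoined. The final segment serves as the
inner polygon, since it refines the step from `A_i` to `A_{+∞}`. -/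
theorem isDiagonal_segments (i r : ℕ) :
    IsDiagonal (QuotientDatum.extendTop (finalSegment i r).toOrderHom)
      (QuotientDatum.extendTop (initialSegment i r).toOrderHom)
      (QuotientDatum.extendTop (const ⦋0⦌ ⦋r⦌ 0).toOrderHom)
      (QuotientDatum.extendTop (const ⦋0⦌ ⦋i⦌ (Fin.last i)).toOrderHom) where
  isDecomposition :=
    { le := le_top
      outer_bot_le k := by
        cases k with
        | top => exact le_top
        | coe k => exact WithTop.coe_le_coe.2 (Fin.le_def.2 (Nat.zero_le _))
      le_outer_top k := le_top
      left := rfl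
      right := rfl
      cover k := by
        cases k with
        | top => exact Or.inl ⟨⊤, rfl⟩
        | coe k =>
          have hk := val_le k
          rcases le_or_gt (k : ℕ) i with h | h
          · exact Or.inl ⟨((⟨k, Nat.lt_succ_iff.2 h⟩ : Fin (⦋i⦌.len + 1)) : WithTop _), rfl⟩
          · refine Or.inr ⟨((⟨k - i, by simp only [SimplexCategory.len_mk]; omega⟩ :
              Fin (⦋r⦌.len + 1)) : WithTop _), congrArg WithTop.some (Fin.ext ?_)⟩
            rw [finalSegment_val]
            simp only
            omega
      le_of_inner_le_inner {l l'} h := by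
        cases l' with
        | top => exact le_top
        | coe l' =>
          cases l with
          | top => exact absurd (top_le_iff.1 h) WithTop.coe_ne_top
          | coe l =>
            have h' := WithTop.coe_le_coe.1 h
            rw [Fin.le_def, finalSegment_val, finalSegment_val] at h'
            exact WithTop.coe_le_coe.2 (Fin.le_def.2 (by omega))
      le_of_outer_le_outer {j j'} h := by
        refine Or.inl ?_
        cases j' with
        | top => exact le_top
        | coe j' =>
          cases j with
          | top => exact absurd (top_le_iff.1 h) WithTop.coe_ne_top
          | coe j =>
            have h' : (initialSegment i r).toOrderHom j ≤ (initialSegment i r).toOrderHom j' :=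
              WithTop.coe_le_coe.1 h
            rw [Fin.le_def, initialSegment_val, initialSegment_val] at h'
            exact WithTop.coe_le_coe.2 (Fin.le_def.2 h')
      le_of_outer_le_inner {j l} h := by
        cases l with
        | top => exact Or.inr ⟨le_top, le_top⟩
        | coe l =>
          cases j with
          | top => exact absurd (top_le_iff.1 h) WithTop.coe_ne_top
          | coe j => exact Or.inl (WithTop.coe_le_coe.2 (Fin.le_last j))
      le_of_inner_le_outer {l j} h := by
        cases j with
        | top => exact Or.inl le_top
        | coe j =>
          cases l with
          | top => exact absurd (top_le_iff.1 h) WithTop.coe_ne_top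
          | coe l =>
            have h' := WithTop.coe_le_coe.1 h
            rw [Fin.le_def, finalSegment_val, initialSegment_val] at h'
            have hj := val_le j
            refine Or.inr ⟨WithTop.coe_le_coe.2 (Fin.le_def.2 ?_),
              WithTop.coe_le_coe.2 (Fin.le_def.2 ?_)⟩
            · rw [bot_val]
              omega
            · change i ≤ (j : ℕ)
              omega }
  map_bot := rfl
  map_top := rfl
  comm := by
    ext k
    cases k with
    | top => rfl
    | coe k => rfl

theorem polygon_comm (i m r : ℕ) :
    endpoints m ≫ innerPolygon i m r = innerPolygon i 1 r ≫ outerPolygon i m r :=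
  SimplexCategory.Hom.ext _ _ (isDiagonal_polygon i m r).comm

theorem segments_comm (i r : ℕ) :
    const ⦋0⦌ ⦋i⦌ (Fin.last i) ≫ initialSegment i r = const ⦋0⦌ ⦋r⦌ 0 ≫ finalSegment i r :=
  SimplexCategory.Hom.ext _ _ rfl

end TwoSegal

/-! ### The three families of homotopy pullbacks -/

theorem mainTheorem7 {A : Type u} [Category.{v} A] [ProtoAbelian A] (Q : QuotientDatum A) :
    TwoSegal.IsTwoSegalMorphism Q.boundedSToWaldhausenS where
  isTwoSegal i m r := by
    have hc : (waldhausenS A).map (TwoSegal.innerPolygon i m r).op ≫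
        (waldhausenS A).map (TwoSegal.endpoints m).op =
        (waldhausenS A).map (TwoSegal.outerPolygon i m r).op ≫
        (waldhausenS A).map (TwoSegal.innerPolygon i 1 r).op := by
      rw [← Functor.map_comp, ← Functor.map_comp, ← op_comp, ← op_comp, TwoSegal.polygon_comm]
    exact ⟨hc, (TwoSegal.isDiagonal_polygon i m r).comparison_isEquivalence hc⟩
  finite_diagonal i m r := by
    have hc : (Q.boundedS.map (TwoSegal.innerPolygon i m r).op ≫
        Q.boundedSToWaldhausenS.app _) ≫ (waldhausenS A).map (TwoSegal.endpoints m).op =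
        Q.boundedS.map (TwoSegal.outerPolygon i m r).op ≫
        Q.boundedS.map (TwoSegal.innerPolygon i 1 r).op ≫ Q.boundedSToWaldhausenS.app _ := by
      rw [Category.assoc, ← NatTrans.naturality, ← Functor.map_comp_assoc,
        ← Functor.map_comp_assoc, ← op_comp, ← op_comp, TwoSegal.polygon_comm]
    exact ⟨hc, QuotientDatum.comparison_isEquivalence_of_finite
      (TwoSegal.isDiagonal_polygon i m r) hc⟩
  infinite_diagonal i r := by
    have hc : Q.boundedS.map (TwoSegal.initialSegment i r).op ≫
        Q.boundedS.map (SimplexCategory.const (.mk 0) (.mk i) (Fin.last i)).op =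
        Q.boundedS.map (TwoSegal.finalSegment i r).op ≫
        Q.boundedS.map (SimplexCategory.const (.mk 0) (.mk r) 0).op := by
      rw [← Functor.map_comp, ← Functor.map_comp, ← op_comp, ← op_comp, TwoSegal.segments_comm]
    exact ⟨hc, QuotientDatum.comparison_isEquivalence_of_infinite
      (TwoSegal.isDiagonal_segments i r) hc⟩
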